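/- Let $k$ be a field and let $Q$ be a finite quiver whose underlying unoriented graph $\Gamma$ is of type $A_n$ ($n\ge 1$), $D_n$ ($n\ge 4$), $E_6$, $E_7$ or $E_8$. Let $I$ be the set of vertices, $R_\Gamma$ the adjacency matrix of $\Gamma$, $A_\Gamma=2\,\mathrm{Id}-R_\Gamma$, and $B_\Gamma(x,y)=x^{T}A_\Gamma y$ for $x,y\in\mathbb Z^{I}$. A root is a shortest nonzero vector of $\mathbb Z^{I}$ with respect to $B_\Gamma$, and a positive root is a root with all coordinates $\ge 0$. A representation $V$ of $Q$ over $k$ consists of a $k$-vector space $V_i$ for each vertex $i$ and a linear map $V_i\to V_j$ for each arrow $i\to j$; it is indecomposable if it is nonzero and not isomorphic to a direct sum of two nonzero representations. Its dimension vector is $d(V)=(\dim V_i)_{i\in I}$. Theorem (Gabriel's theorem). Up to isomorphism, $Q$ has finitely many indecomposable representations over $k$. More precisely, every indecomposable representation $V$ of $Q$ over $k$ is finite-dimensional and its dimension vector $d(V)$ is a positive root; and for every positive root $\alpha$ there is, up to isomorphism, exactly one indecomposable representation $V$ of $Q$ over $k$ with $d(V)=\alpha$. -/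

import Mathlib

universe u v w

/-! ### The graphs of type `A`, `D`, `E` -/

/-- The graph on `n` vertices `0, …, n - 1` consisting of the path `0 — 1 — ⋯ — (n - 2)` and of one
further vertex `n - 1`, joined to the vertex `m` of the path only. -/
def branchedPath (n m : ℕ) : SimpleGraph (Fin n) :=
  SimpleGraph.fromRel fun i j : Fin n =>
    (i.val + 1 = j.val ∧ j.val + 1 < n) ∨ (i.val = m ∧ j.val + 1 = n)

/-- `Γ` is of type `A_n` (`n ≥ 1`), `D_n` (`n ≥ 4`), `E_6`, `E_7` or `E_8`. -/
def IsADE {I : Type v} (Γ : SimpleGraph I) : Prop :=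
  (∃ n : ℕ, 1 ≤ n ∧ Nonempty (Γ ≃g SimpleGraph.pathGraph n)) ∨
  (∃ n : ℕ, 4 ≤ n ∧ Nonempty (Γ ≃g branchedPath n 1)) ∨
  Nonempty (Γ ≃g branchedPath 6 2) ∨
  Nonempty (Γ ≃g branchedPath 7 2) ∨
  Nonempty (Γ ≃g branchedPath 8 2)

/-! ### The underlying graph of a quiver -/

open Classical in
/-- The number of edges joining `i` and `j` in the underlying unoriented graph of a finite quiver
(for `i = j`, the number of loops at `i`). -/
noncomputable def edgeCount {I : Type v} [Quiver.{w} I] (i j : I) : ℕ :=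
  if i = j then Nat.card (i ⟶ i) else Nat.card (i ⟶ j) + Nat.card (j ⟶ i)

open Classical in
/-- The simple graph `Γ` is the underlying unoriented graph of the (finite) quiver on `I`: exactly
one arrow joins adjacent vertices, and there are no other arrows. -/
def IsUnderlyingGraph {I : Type v} [Quiver.{w} I] (Γ : SimpleGraph I) : Prop :=
  ∀ i j : I, edgeCount i j = if Γ.Adj i j then 1 else 0

/-! ### Roots -/

section Roots

variable {I : Type v} [Fintype I] [DecidableEq I] (Γ : SimpleGraph I) [DecidableRel Γ.Adj]

/-- The Cartan matrix `2 Id - R`, with `R` the adjacency matrix of `Γ`. -/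
def cartanMatrix : Matrix I I ℤ := (2 : ℤ) • (1 : Matrix I I ℤ) - Γ.adjMatrix ℤ

/-- The Cartan form `B(x, y) = xᵀ A y` on the lattice `ℤ^I`. -/
def cartanForm (x y : I → ℤ) : ℤ := x ⬝ᵥ (cartanMatrix Γ).mulVec y

/-- A root is a shortest nonzero vector of the lattice `ℤ^I` with respect to the Cartan form. -/
def IsRoot (x : I → ℤ) : Prop :=
  x ≠ 0 ∧ ∀ y : I → ℤ, y ≠ 0 → cartanForm Γ x x ≤ cartanForm Γ y y

/-- A positive root is a root all of whose coordinates are nonnegative. -/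
def IsPositiveRoot (x : I → ℤ) : Prop := IsRoot Γ x ∧ ∀ i, 0 ≤ x i

end Roots

/-! ### Representations of quivers -/

/-- A representation over `k` of the quiver on the vertex set `I`. The vector spaces need not be
finite-dimensional. -/
structure QuiverRep (k : Type u) [Field k] (I : Type v) [Quiver.{w} I] where
  /-- The vector space at a vertex. -/
  space : I → Type (max u v w)
  [addCommGroup : ∀ i, AddCommGroup (space i)]
  [module : ∀ i, Module k (space i)]
  /-- The linear map along an arrow. -/
  map : ∀ {i j : I}, (i ⟶ j) → space i →ₗ[k] space j

namespace QuiverRep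

attribute [instance] QuiverRep.addCommGroup QuiverRep.module

variable {k : Type u} [Field k] {I : Type v} [Quiver.{w} I]

/-- Isomorphism of representations: linear isomorphisms at all vertices that commute with the maps
along all arrows. -/
def IsIsomorphic (V W : QuiverRep k I) : Prop :=
  ∃ φ : ∀ i, V.space i ≃ₗ[k] W.space i,
    ∀ (i j : I) (h : i ⟶ j) (x : V.space i), φ j (V.map h x) = W.map h (φ i x)

/-- The direct sum of two representations. -/
def directSum (V W : QuiverRep k I) : QuiverRep k I where
  space i := V.space i × W.space i
  map h := (V.map h).prodMap (W.map h)

/-- The zero representation: all spaces are zero. -/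
def IsZero (V : QuiverRep k I) : Prop := ∀ i, Subsingleton (V.space i)

/-- A representation is indecomposable if it is nonzero and not isomorphic to a direct sum of two
nonzero representations. -/
def IsIndecomposable (V : QuiverRep k I) : Prop :=
  ¬ V.IsZero ∧ ¬ ∃ V₁ V₂ : QuiverRep k I,
    ¬ V₁.IsZero ∧ ¬ V₂.IsZero ∧ V.IsIsomorphic (V₁.directSum V₂)

/-- All spaces of the representation are finite-dimensional. -/
def IsFiniteDimensional (V : QuiverRep k I) : Prop := ∀ i, FiniteDimensional k (V.space i)

/-- The dimension vector (meaningful for finite-dimensional representations). -/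
noncomputable def dimVector (V : QuiverRep k I) : I → ℤ :=
  fun i => (Module.finrank k (V.space i) : ℤ)

theorem IsIsomorphic.refl (V : QuiverRep k I) : V.IsIsomorphic V :=
  ⟨fun _ => LinearEquiv.refl k _, fun _ _ _ _ => rfl⟩

theorem IsIsomorphic.symm {V W : QuiverRep k I} : V.IsIsomorphic W → W.IsIsomorphic V := by
  rintro ⟨φ, hφ⟩
  refine ⟨fun i => (φ i).symm, fun i j h x => ?_⟩
  rw [LinearEquiv.symm_apply_eq, hφ, LinearEquiv.apply_symm_apply]

theorem IsIsomorphic.trans {V W X : QuiverRep k I} :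
    V.IsIsomorphic W → W.IsIsomorphic X → V.IsIsomorphic X := by
  rintro ⟨φ, hφ⟩ ⟨ψ, hψ⟩
  refine ⟨fun i => (φ i).trans (ψ i), fun i j h x => ?_⟩
  simp only [LinearEquiv.trans_apply, hφ, hψ]

variable (k I) in
/-- Isomorphism, as an equivalence relation on the indecomposable representations. -/
def indecomposableSetoid : Setoid {V : QuiverRep k I // V.IsIndecomposable} where
  r V W := V.1.IsIsomorphic W.1
  iseqv := ⟨fun V => IsIsomorphic.refl V.1, IsIsomorphic.symm, IsIsomorphic.trans⟩

variable (k I) in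
/-- Isomorphism classes of indecomposable representations. -/
def IndecomposableClass : Type _ := Quotient (indecomposableSetoid k I)

end QuiverRep

/-!
Roots are the vectors of norm `1` for the Euler form
`⟨x, y⟩ = ∑ i, x_i y_i - ∑ (a : i ⟶ j), x_i y_j`, whose norm is half the Cartan form.
The proof rests on the identity `⟨dim V, dim W⟩ = dim Hom(V, W) - dim Ext¹(V, W)`
(`finrank_Hom_eq`), where `Ext¹` is the cokernel of the map `coboundary` whose kernel is `Hom`.
The functor `Ext¹` is right exact in both arguments. No reflection functors are used, and the field
is arbitrary.

*Positivity.* A graph with a positive weight `v` such that `A v` is positive (`IsSuperharmonic`) has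
a positive definite Cartan form, with finitely many vectors of each norm. For the graphs of type
`A`, `D`, `E`, the sum of the positive roots is such a weight, up to a factor.

*Finite-dimensional indecomposables are bricks* (`IsIndecomposable.isBrick`). If `V` has a nonzero
noninvertible endomorphism, it has a nonzero `θ` with `θ² = 0`, and one of minimal rank produces an
indecomposable `A` of smaller dimension, a summand of `ker θ`, with `Ext¹(A, A) ≠ 0`. By induction
`A` is a brick, so `Ext¹(A, A)` is a nonzero vector space over `End(A)` and `⟨dim A, dim A⟩ ≤ 0`, a
contradiction. The same argument gives `Ext¹(V, V) = 0`, so that `⟨dim V, dim V⟩` is the dimension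
of the division algebra `End(V)`; a divisibility argument shows that it is `1`.

*Uniqueness* (`IsIndecomposable.isIsomorphic_of_dimVector_eq`). If `dim X = dim Y`, there is a
nonzero `f : X → Y`, with image `J`, say. Then `Ext¹(X, J) = 0`, so `⟨dim Y, dim J⟩ > 0`, and a
nonzero map `Y → J ⊆ Y` is invertible because `Y` is a brick. Hence `f` is surjective.

*Existence* (`exists_isIndecomposable_dimVector_eq`). A representation whose dimension vector is a
positive root and whose endomorphism algebra has minimal dimension is indecomposable: nonsplit
extensions have fewer endomorphisms than direct sums, so in a decomposition `U ⊕ V` both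
`Ext¹(U, V)` and `Ext¹(V, U)` vanish, and the norm of `dim U + dim V` is at least `2`.

*Finite dimension* (`IsIndecomposable.isFiniteDimensional`). As the quiver has no oriented
cycles, an arbitrary `V` is the union of its finite-dimensional subrepresentations. There are
finitely many finite-dimensional indecomposables and they are bricks, so some map `g : X → V` from one of them
splits on each finite-dimensional subrepresentation containing its image. By a compactness argument
(`exists_Hom_apply_ne_zero`), `X` is a direct summand of `V`.
-/

/-! ### Positivity of the Cartan form -/

section CartanForm

theorem Finset.sum_ite_le_of_forall_eq {n : ℕ} {p : Fin n → Prop} [DecidablePred p] {c F : ℤ}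
    {g : Fin n → ℤ} (hF : 0 ≤ F) (hp : ∀ j, p j → (j.val : ℤ) = c ∧ g j ≤ F) :
    (∑ j, if p j then g j else 0) ≤ F := by
  by_cases h : ∃ j, p j
  · obtain ⟨j, hj⟩ := h
    rw [Finset.sum_eq_single j]
    · simpa [hj] using (hp j hj).2
    · intro l _ hl
      refine if_neg fun hpl => hl (Fin.ext ?_)
      have := (hp j hj).1
      have := (hp l hpl).1
      omega
    · simp
  · rw [Finset.sum_eq_zero fun j _ => if_neg fun hj => h ⟨j, hj⟩]
    exact hF

theorem Finset.sum_ite_or_le {ι : Type*} [Fintype ι] {p q : ι → Prop} [DecidablePred p]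
    [DecidablePred q] {g : ι → ℤ} (hg : ∀ j, 0 ≤ g j) :
    (∑ j, if p j ∨ q j then g j else 0) ≤
      (∑ j, if p j then g j else 0) + ∑ j, if q j then g j else 0 := by
  rw [← Finset.sum_add_distrib]
  refine Finset.sum_le_sum fun j _ => ?_
  have := hg j
  split_ifs <;> simp_all

/-- A weight `v` is strictly superharmonic if it is positive and `A v` has positive entries, where
`A` is the Cartan matrix of the graph. The existence of such a weight forces the Cartan form to be
positive definite. -/
def IsSuperharmonic {I : Type*} [Fintype I] (Γ : SimpleGraph I) (v : I → ℤ) : Prop :=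
  (∀ i, 0 < v i) ∧
    ∀ (_ : DecidableRel Γ.Adj) (i : I), (∑ j, if Γ.Adj i j then v j else 0) < 2 * v i

theorem IsSuperharmonic.comp_iso {I J : Type*} [Fintype I] [Fintype J] {Γ : SimpleGraph I}
    {Δ : SimpleGraph J} {v : J → ℤ} (hv : IsSuperharmonic Δ v) (e : Γ ≃g Δ) :
    IsSuperharmonic Γ (v ∘ e) := by
  classical
  refine ⟨fun i => hv.1 _, fun _ i => ?_⟩
  refine lt_of_eq_of_lt ?_ (hv.2 (Classical.decRel _) (e i))
  rw [← Equiv.sum_comp e.toEquiv]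
  refine Finset.sum_congr rfl fun j _ => ?_
  have : Δ.Adj (e i) (e j) ↔ Γ.Adj i j := e.map_rel_iff
  exact if_congr this.symm rfl rfl

/-- The weight is the sum of the positive roots of `A_n`. -/
theorem isSuperharmonic_pathGraph (n : ℕ) :
    IsSuperharmonic (SimpleGraph.pathGraph n) fun i => (i.val + 1) * (n - i.val) := by
  have hpos : ∀ i : Fin n, (0 : ℤ) < (i.val + 1) * (n - i.val) := fun i => by
    have := i.2
    exact mul_pos (by omega) (by omega)
  refine ⟨hpos, fun _ i => ?_⟩
  have hi := i.2
  have h1 : (∑ j : Fin n, if i.val + 1 = j.val then ((j.val : ℤ) + 1) * (n - j.val) else 0) ≤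
      ((i.val : ℤ) + 2) * (n - i.val - 1) :=
    Finset.sum_ite_le_of_forall_eq (c := i.val + 1) (mul_nonneg (by omega) (by omega))
      fun j hj => ⟨by omega, by rw [← hj]; push_cast; linarith⟩
  have h2 : (∑ j : Fin n, if j.val + 1 = i.val then ((j.val : ℤ) + 1) * (n - j.val) else 0) ≤
      (i.val : ℤ) * (n - i.val + 1) :=
    Finset.sum_ite_le_of_forall_eq (c := i.val - 1) (mul_nonneg (by omega) (by omega))
      fun j hj => ⟨by omega, by rw [← hj]; push_cast; linarith⟩
  have h3 := Finset.sum_ite_or_le (p := fun j : Fin n => i.val + 1 = j.val)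
    (q := fun j => j.val + 1 = i.val) fun j => (hpos j).le
  simp only [SimpleGraph.pathGraph_adj]
  calc _ ≤ _ := le_of_eq (Finset.sum_congr rfl fun j _ => if_congr Iff.rfl rfl rfl)
    _ ≤ _ := h3
    _ < _ := by linarith

theorem branchedPath_adj {n m : ℕ} {i j : Fin n} : (branchedPath n m).Adj i j ↔
    i ≠ j ∧ (((i.val + 1 = j.val ∧ j.val + 1 < n) ∨ (i.val = m ∧ j.val + 1 = n)) ∨
      ((j.val + 1 = i.val ∧ i.val + 1 < n) ∨ (j.val = m ∧ i.val + 1 = n))) := by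
  simp [branchedPath]

/-- The weight is twice the sum of the positive roots of `D_n`. -/
theorem isSuperharmonic_branchedPath_one {n : ℕ} (hn : 4 ≤ n) :
    IsSuperharmonic (branchedPath n 1) fun i =>
      if i.val = 0 ∨ i.val + 1 = n then (n : ℤ) * (n - 1)
      else 2 * ((n - 1 - i.val) * (n + i.val)) := by
  set f : ℕ → ℤ := fun t => if t = 0 ∨ t + 1 = n then (n : ℤ) * (n - 1)
      else 2 * ((n - 1 - t) * (n + t)) with hf
  have hpos : ∀ i : Fin n, 0 < f i := fun i => by
    have := i.2
    simp only [hf]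
    split_ifs with h
    · exact mul_pos (by omega) (by omega)
    · exact mul_pos (by omega) (mul_pos (by omega) (by omega))
  refine ⟨hpos, fun _ i => ?_⟩
  have hi := i.2
  -- `p₁` and `p₃` describe the neighbours of `i` along the path, `p₂` and `p₄` the edge joining the
  -- branch vertex `1` to the extra vertex `n - 1`
  obtain ⟨p₁, hp₁⟩ : ∃ p : Fin n → Prop, ∀ j, p j ↔ i.val + 1 = j.val ∧ j.val + 1 < n :=
    ⟨_, fun _ => Iff.rfl⟩
  obtain ⟨p₂, hp₂⟩ : ∃ p : Fin n → Prop, ∀ j, p j ↔ i.val = 1 ∧ j.val + 1 = n :=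
    ⟨_, fun _ => Iff.rfl⟩
  obtain ⟨p₃, hp₃⟩ : ∃ p : Fin n → Prop, ∀ j, p j ↔ j.val + 1 = i.val ∧ i.val + 1 < n :=
    ⟨_, fun _ => Iff.rfl⟩
  obtain ⟨p₄, hp₄⟩ : ∃ p : Fin n → Prop, ∀ j, p j ↔ j.val = 1 ∧ i.val + 1 = n :=
    ⟨_, fun _ => Iff.rfl⟩
  have hadj : ∀ j, (branchedPath n 1).Adj i j → (p₁ j ∨ p₂ j) ∨ (p₃ j ∨ p₄ j) := fun j h => by
    simpa only [hp₁, hp₂, hp₃, hp₄] using (branchedPath_adj.1 h).2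
  classical
  have hle : (∑ j, if (branchedPath n 1).Adj i j then f j else 0) ≤
      ((∑ j, if p₁ j then f j else 0) + ∑ j, if p₂ j then f j else 0) +
      ((∑ j, if p₃ j then f j else 0) + ∑ j, if p₄ j then f j else 0) := by
    refine le_trans ?_ (add_le_add (Finset.sum_ite_or_le fun j => (hpos j).le)
      (Finset.sum_ite_or_le fun j => (hpos j).le))
    refine le_trans ?_ (Finset.sum_ite_or_le fun j => (hpos j).le)
    refine Finset.sum_le_sum fun j _ => ?_
    have h0 := (hpos j).le
    by_cases h : (branchedPath n 1).Adj i j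
    · rw [if_pos h, if_pos (hadj j h)]
    · rw [if_neg h]
      split_ifs <;> first | exact h0 | exact le_rfl
  have key : ∀ {p : Fin n → Prop} (c F : ℤ), 0 ≤ F →
      (∀ j, p j → (j.val : ℤ) = c ∧ f j ≤ F) → (∑ j, if p j then f j else 0) ≤ F :=
    fun c F h0 h => Finset.sum_ite_le_of_forall_eq h0 h
  refine lt_of_le_of_lt (le_trans (le_of_eq ?_) hle) (b := _) ?_
  · exact Finset.sum_congr rfl fun j _ => if_congr Iff.rfl rfl rfl
  have hn' : (4 : ℤ) ≤ n := by exact_mod_cast hn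
  have f1 : f 1 = 2 * ((n - 2) * (n + 1)) := by
    simp only [hf]; rw [if_neg (by omega)]; push_cast; ring
  have hf1 : 0 ≤ f 1 := by
    rw [f1]
    exact mul_nonneg (by norm_num) (mul_nonneg (by omega) (by omega))
  have hn1 : (0 : ℤ) ≤ n * (n - 1) := mul_nonneg (by omega) (by omega)
  have hend : ∀ t, t = 0 ∨ t + 1 = n → f t = n * (n - 1) := fun t ht => if_pos ht
  have hmid : ∀ t : ℕ, t ≠ 0 → t + 1 ≠ n → f t = 2 * ((n - 1 - t) * (n + t)) := fun t h h' =>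
    if_neg (by omega)
  change _ < 2 * f i
  by_cases h0 : i.val = 0
  · have e1 := key (p := p₁) 1 (f 1) hf1 fun j hj' =>
      have hj := (hp₁ j).1 hj'
      ⟨by omega, by rw [← hj.1, h0]⟩
    have e2 := key (p := p₂) 1 0 le_rfl fun j hj' => by
      have := (hp₂ j).1 hj'; omega
    have e3 := key (p := p₃) 1 0 le_rfl fun j hj' => by
      have := (hp₃ j).1 hj'; omega
    have e4 := key (p := p₄) 1 0 le_rfl fun j hj' => by
      have := (hp₄ j).1 hj'; omega
    rw [hend i (Or.inl h0)]
    linarith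
  by_cases hl : i.val + 1 = n
  · have e1 := key (p := p₁) 1 0 le_rfl fun j hj' => by
      have := (hp₁ j).1 hj'; omega
    have e2 := key (p := p₂) 1 0 le_rfl fun j hj' => by
      have := (hp₂ j).1 hj'; omega
    have e3 := key (p := p₃) 1 0 le_rfl fun j hj' => by
      have := (hp₃ j).1 hj'; omega
    have e4 := key (p := p₄) 1 (f 1) hf1 fun j hj' =>
      have hj := (hp₄ j).1 hj'
      ⟨by omega, by rw [hj.1]⟩
    rw [hend i (Or.inr hl)]
    linarith
  have e4 := key (p := p₄) 1 0 le_rfl fun j hj' => by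
      have := (hp₄ j).1 hj'; omega
  have e1 := key (p := p₁) (i.val + 1) (2 * ((n - 2 - i.val) * (n + i.val + 1)))
    (mul_nonneg (by norm_num) (mul_nonneg (by omega) (by omega))) fun j hj' =>
      have hj := (hp₁ j).1 hj'
      ⟨by omega, by rw [hmid j (by omega) (by omega), ← hj.1]; push_cast; linarith⟩
  rw [hmid i h0 hl]
  by_cases h1 : i.val = 1
  · have e2 := key (p := p₂) (n - 1) (n * (n - 1)) hn1 fun j hj' =>
      have hj := (hp₂ j).1 hj'
      ⟨by omega, (hend j (Or.inr hj.2)).le⟩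
    have e3 := key (p := p₃) 0 (n * (n - 1)) hn1 fun j hj' =>
      have hj := (hp₃ j).1 hj'
      ⟨by omega, (hend j (by omega)).le⟩
    have h1' : (i.val : ℤ) = 1 := by exact_mod_cast h1
    rw [h1'] at e1 ⊢
    linarith
  · have e2 := key (p := p₂) 1 0 le_rfl fun j hj' => by
      have := (hp₂ j).1 hj'; omega
    have e3 := key (p := p₃) (i.val - 1) (2 * ((n - i.val) * (n + i.val - 1)))
      (mul_nonneg (by norm_num) (mul_nonneg (by omega) (by omega))) fun j hj' =>
      have hj := (hp₃ j).1 hj'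
      ⟨by omega, by rw [hmid j (by omega) (by omega), ← hj.1]; push_cast; linarith⟩
    linarith

/-- The weight is the sum of the positive roots of `E_6`. -/
theorem isSuperharmonic_branchedPath_six :
    IsSuperharmonic (branchedPath 6 2) ![16, 30, 42, 30, 16, 22] := by
  refine ⟨by decide, fun _ i => lt_of_eq_of_lt
    (Finset.sum_congr rfl fun j _ => if_congr branchedPath_adj rfl rfl) ?_⟩
  revert i
  decide

/-- The weight is the sum of the positive roots of `E_7`. -/
theorem isSuperharmonic_branchedPath_seven :
    IsSuperharmonic (branchedPath 7 2) ![34, 66, 96, 75, 52, 27, 49] := by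
  refine ⟨by decide, fun _ i => lt_of_eq_of_lt
    (Finset.sum_congr rfl fun j _ => if_congr branchedPath_adj rfl rfl) ?_⟩
  revert i
  decide

/-- The weight is the sum of the positive roots of `E_8`. -/
theorem isSuperharmonic_branchedPath_eight :
    IsSuperharmonic (branchedPath 8 2) ![92, 182, 270, 220, 168, 114, 58, 136] := by
  refine ⟨by decide, fun _ i => lt_of_eq_of_lt
    (Finset.sum_congr rfl fun j _ => if_congr branchedPath_adj rfl rfl) ?_⟩
  revert i
  decide

theorem IsADE.exists_isSuperharmonic {I : Type v} [Fintype I] {Γ : SimpleGraph I}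
    (hΓ : IsADE Γ) : ∃ v, IsSuperharmonic Γ v := by
  rcases hΓ with ⟨n, -, ⟨e⟩⟩ | ⟨n, hn, ⟨e⟩⟩ | ⟨⟨e⟩⟩ | ⟨⟨e⟩⟩ | ⟨⟨e⟩⟩
  · exact ⟨_, (isSuperharmonic_pathGraph n).comp_iso e⟩
  · exact ⟨_, (isSuperharmonic_branchedPath_one hn).comp_iso e⟩
  · exact ⟨_, isSuperharmonic_branchedPath_six.comp_iso e⟩
  · exact ⟨_, isSuperharmonic_branchedPath_seven.comp_iso e⟩
  · exact ⟨_, isSuperharmonic_branchedPath_eight.comp_iso e⟩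

variable {I : Type v} [Fintype I] [DecidableEq I] {Γ : SimpleGraph I} [DecidableRel Γ.Adj]

theorem cartanForm_self_eq (x : I → ℤ) : cartanForm Γ x x =
    2 * ∑ i, x i * x i - ∑ i, ∑ j, if Γ.Adj i j then x i * x j else 0 := by
  rw [cartanForm, cartanMatrix, Matrix.sub_mulVec, dotProduct_sub]
  congr 1
  · rw [Matrix.smul_mulVec, Matrix.one_mulVec, dotProduct_smul, smul_eq_mul, dotProduct]
  · simp [dotProduct, Matrix.mulVec, SimpleGraph.adjMatrix_apply, Finset.mul_sum]

/-- For a strictly superharmonic weight `v`, the inequality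
`2 x_i x_j ≤ x_i² v_j / v_i + x_j² v_i / v_j` summed over the edges bounds every coordinate of `x`
in terms of the Cartan form. -/
theorem IsSuperharmonic.sq_le {v : I → ℤ} (hv : IsSuperharmonic Γ v) (x : I → ℤ) (i : I) :
    x i ^ 2 ≤ v i * cartanForm Γ x x := by
  have hpos : ∀ i, (0 : ℚ) < v i := fun i => by exact_mod_cast hv.1 i
  have hA : (∑ i, ∑ j, if Γ.Adj i j then (x i : ℚ) * x j else 0) ≤
      ∑ i, ∑ j, if Γ.Adj i j then (x i : ℚ) ^ 2 / v i * v j else 0 := by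
    have hS : (∑ i, ∑ j, if Γ.Adj i j then (x i : ℚ) ^ 2 / v i * v j else 0) =
        ∑ i, ∑ j, if Γ.Adj i j then (x j : ℚ) ^ 2 / v j * v i else 0 := by
      rw [Finset.sum_comm]
      exact Finset.sum_congr rfl fun i _ => Finset.sum_congr rfl fun j _ =>
        if_congr (Γ.adj_comm _ _) rfl rfl
    suffices h : 2 * (∑ i, ∑ j, if Γ.Adj i j then (x i : ℚ) * x j else 0) ≤
        (∑ i, ∑ j, if Γ.Adj i j then (x i : ℚ) ^ 2 / v i * v j else 0) +
        ∑ i, ∑ j, if Γ.Adj i j then (x j : ℚ) ^ 2 / v j * v i else 0 by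
      rw [← hS] at h; linarith
    simp only [Finset.mul_sum, ← Finset.sum_add_distrib]
    refine Finset.sum_le_sum fun i _ => Finset.sum_le_sum fun j _ => ?_
    split_ifs
    · have hi := hpos i
      have hj := hpos j
      have : (x i : ℚ) ^ 2 / v i * v j + (x j : ℚ) ^ 2 / v j * v i - 2 * (x i * x j) =
          (x i * v j - x j * v i) ^ 2 / (v i * v j) := by
        field_simp
        ring
      have h0 : (0 : ℚ) ≤ (x i * v j - x j * v i) ^ 2 / (v i * v j) := by positivity
      linarith
    · simp
  have hB : ∀ i, (∑ j, if Γ.Adj i j then (x i : ℚ) ^ 2 / v i * v j else 0) ≤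
      2 * (x i : ℚ) ^ 2 - (x i : ℚ) ^ 2 / v i := fun i => by
    have h := hv.2 inferInstance i
    have h' : (∑ j, if Γ.Adj i j then (v j : ℚ) else 0) ≤ 2 * v i - 1 := by
      have : (∑ j, if Γ.Adj i j then v j else 0) ≤ 2 * v i - 1 := by omega
      exact_mod_cast this
    calc _ = (x i : ℚ) ^ 2 / v i * ∑ j, if Γ.Adj i j then (v j : ℚ) else 0 := by
          simp [Finset.mul_sum]
      _ ≤ (x i : ℚ) ^ 2 / v i * (2 * v i - 1) :=
          mul_le_mul_of_nonneg_left h' (div_nonneg (sq_nonneg _) (hpos i).le)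
      _ = _ := by have := (hpos i).ne'; field_simp
  have hC : (∑ i, (x i : ℚ) ^ 2 / v i) ≤ (cartanForm Γ x x : ℚ) := by
    have h1 := hA.trans (Finset.sum_le_sum fun i _ => hB i)
    rw [Finset.sum_sub_distrib, ← Finset.mul_sum] at h1
    rw [cartanForm_self_eq]
    push_cast
    simp only [← pow_two]
    linarith
  have hD := (Finset.single_le_sum (f := fun i => (x i : ℚ) ^ 2 / v i)
    (fun j _ => div_nonneg (sq_nonneg _) (hpos j).le) (Finset.mem_univ i)).trans hC
  rw [div_le_iff₀ (hpos i)] at hD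
  rw [mul_comm]
  exact_mod_cast hD

theorem IsSuperharmonic.cartanForm_pos {v : I → ℤ} (hv : IsSuperharmonic Γ v) {x : I → ℤ}
    (hx : x ≠ 0) : 0 < cartanForm Γ x x := by
  obtain ⟨i, hi⟩ := Function.ne_iff.1 hx
  have h := hv.sq_le x i
  have h1 : 0 < x i ^ 2 := sq_pos_of_ne_zero hi
  exact pos_of_mul_pos_right (h1.trans_le h) (hv.1 i).le

theorem IsSuperharmonic.finite_cartanForm_eq {v : I → ℤ} (hv : IsSuperharmonic Γ v) (c : ℤ) :
    {x : I → ℤ | cartanForm Γ x x = c}.Finite := by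
  refine (Set.finite_Icc (fun i => -(v i * c)) fun i => v i * c).subset fun x hx => ?_
  have h : ∀ i, |x i| ≤ v i * c := fun i => by
    have := hv.sq_le x i
    rw [show cartanForm Γ x x = c from hx] at this
    rw [← sq_abs] at this
    exact (Int.le_self_sq _).trans this
  exact ⟨fun i => (abs_le.1 (h i)).1, fun i => (abs_le.1 (h i)).2⟩

end CartanForm

/-! ### The Euler form of a quiver -/

section EulerForm

variable {I : Type v} [Fintype I] [Quiver.{w} I]

/-- The Euler form `∑ i, x i * y i - ∑ (a : i ⟶ j), x i * y j` of a finite quiver. -/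
noncomputable def eulerForm (x y : I → ℤ) : ℤ :=
  ∑ i, x i * y i - ∑ i, ∑ j, (Nat.card (i ⟶ j) : ℤ) * (x i * y j)

theorem eulerForm_add_left (x x' y : I → ℤ) :
    eulerForm (x + x') y = eulerForm x y + eulerForm x' y := by
  simp only [eulerForm, Pi.add_apply, add_mul, mul_add, Finset.sum_add_distrib]
  ring

theorem eulerForm_add_right (x y y' : I → ℤ) :
    eulerForm x (y + y') = eulerForm x y + eulerForm x y' := by
  simp only [eulerForm, Pi.add_apply, mul_add, Finset.sum_add_distrib]
  ring

theorem eulerForm_smul_smul (c : ℤ) (x : I → ℤ) :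
    eulerForm (c • x) (c • x) = c ^ 2 * eulerForm x x := by
  simp only [eulerForm, Pi.smul_apply, smul_eq_mul, mul_sub, Finset.mul_sum]
  congr 1
  · exact Finset.sum_congr rfl fun i _ => by ring
  · exact Finset.sum_congr rfl fun i _ => Finset.sum_congr rfl fun j _ => by ring

theorem IsUnderlyingGraph.cartanForm_eq [DecidableEq I] {Γ : SimpleGraph I} [DecidableRel Γ.Adj]
    (hQ : IsUnderlyingGraph Γ) (x : I → ℤ) : cartanForm Γ x x = 2 * eulerForm x x := by
  have key : ∀ i j : I, ((if Γ.Adj i j then x i * x j else 0 : ℤ)) =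
      Nat.card (i ⟶ j) * (x i * x j) + Nat.card (j ⟶ i) * (x j * x i) := fun i j => by
    have h := hQ i j
    rw [edgeCount] at h
    by_cases hij : i = j
    · subst hij
      simp only [if_true, SimpleGraph.irrefl, if_false] at h ⊢
      simp [h]
    · rw [if_neg hij] at h
      have h' : (Nat.card (i ⟶ j) : ℤ) + Nat.card (j ⟶ i) = if Γ.Adj i j then 1 else 0 := by
        split_ifs at h ⊢ <;> exact_mod_cast h
      rw [mul_comm (x j), ← add_mul, h']
      simp
  rw [cartanForm_self_eq, eulerForm]
  simp only [key, Finset.sum_add_distrib]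
  rw [Finset.sum_comm (f := fun i j => (Nat.card (j ⟶ i) : ℤ) * (x j * x i))]
  ring

/-- If the Euler form is positive definite, the quiver has no oriented cycles: otherwise there is a
nonempty set of vertices each of which receives an arrow from the set, and the indicator vector of
the set has nonpositive norm. -/
theorem wellFounded_arrow_of_eulerForm_pos [∀ i j : I, Finite (i ⟶ j)]
    (hpos : ∀ x : I → ℤ, x ≠ 0 → 0 < eulerForm x x) :
    WellFounded fun i j : I => Nonempty (i ⟶ j) := by
  classical
  refine WellFounded.wellFounded_iff_has_min.2 fun S hS => ?_
  by_contra! hcon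
  choose! p hpS hp using hcon
  obtain ⟨s, hs⟩ := hS
  set x : I → ℤ := fun i => if i ∈ S then 1 else 0 with hx
  have hx0 : x ≠ 0 := fun h => by simpa [hx, hs] using congrFun h s
  have hx1 : ∀ i, x i * x i = x i := fun i => by by_cases h : i ∈ S <;> simp [hx, h]
  have hx2 : ∀ i, 0 ≤ x i := fun i => by by_cases h : i ∈ S <;> simp [hx, h]
  refine (hpos x hx0).not_ge ?_
  rw [eulerForm, sub_nonpos, Finset.sum_comm]
  refine Finset.sum_le_sum fun j _ => ?_
  by_cases hj : j ∈ S
  · refine le_trans ?_ (Finset.single_le_sum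
      (f := fun i => (Nat.card (i ⟶ j) : ℤ) * (x i * x j))
      (fun i _ => mul_nonneg (Int.natCast_nonneg _) (mul_nonneg (hx2 _) (hx2 _)))
      (Finset.mem_univ (p j)))
    have : 0 < Nat.card (p j ⟶ j) := by
      have := hp j hj
      exact Nat.card_pos
    simp only [hx, hj, hpS j hj, if_true]
    omega
  · simp [hx, hj]

end EulerForm

/-! ### Homomorphisms and extensions of representations -/

namespace QuiverRep

variable {k : Type u} [Field k] {I : Type v} [Quiver.{w} I] {U V W X Y Z : QuiverRep.{u, v, w} k I}

/-- The map whose kernel is `Hom(V, W)` and whose cokernel is `Ext¹(V, W)`: it measures the failure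
of a family of linear maps to commute with the maps along the arrows. -/
def coboundary (V W : QuiverRep.{u, v, w} k I) : (∀ i, V.space i →ₗ[k] W.space i) →ₗ[k]
    (∀ i j : I, (i ⟶ j) → V.space i →ₗ[k] W.space j) where
  toFun f i j h := f j ∘ₗ V.map h - W.map h ∘ₗ f i
  map_add' f g := by
    ext i j h x
    simp only [Pi.add_apply, LinearMap.sub_apply, LinearMap.add_apply, LinearMap.comp_apply,
      map_add]
    abel
  map_smul' c f := by
    ext i j h x
    simp [smul_sub]

theorem coboundary_apply (f : ∀ i, V.space i →ₗ[k] W.space i) {i j : I} (h : i ⟶ j)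
    (x : V.space i) : coboundary V W f i j h x = f j (V.map h x) - W.map h (f i x) :=
  rfl

/-- Homomorphisms of representations, as a subspace of the families of linear maps. -/
def Hom (V W : QuiverRep.{u, v, w} k I) : Submodule k (∀ i, V.space i →ₗ[k] W.space i) :=
  LinearMap.ker (coboundary V W)

theorem mem_Hom {f : ∀ i, V.space i →ₗ[k] W.space i} : f ∈ Hom V W ↔
    ∀ (i j : I) (h : i ⟶ j) (x : V.space i), f j (V.map h x) = W.map h (f i x) := by
  refine ⟨fun hf i j h x => ?_, fun hf => LinearMap.mem_ker.2 ?_⟩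
  · have := congrArg (fun F => F i j h x) (LinearMap.mem_ker.1 hf)
    exact sub_eq_zero.1 this
  · ext i j h x
    exact sub_eq_zero.2 (hf i j h x)

theorem comp_mem_Hom {g : ∀ i, V.space i →ₗ[k] W.space i} (hg : g ∈ Hom V W)
    {f : ∀ i, U.space i →ₗ[k] V.space i} (hf : f ∈ Hom U V) :
    (fun i => g i ∘ₗ f i) ∈ Hom U W :=
  mem_Hom.2 fun i j h x => by
    simp [mem_Hom.1 hf, mem_Hom.1 hg]

theorem id_mem_Hom : (fun _ => LinearMap.id) ∈ Hom V V := mem_Hom.2 fun _ _ _ _ => rfl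

/-- A homomorphism that is bijective at every vertex is an isomorphism. -/
theorem isIsomorphic_of_bijective {f : ∀ i, V.space i →ₗ[k] W.space i} (hf : f ∈ Hom V W)
    (hb : ∀ i, Function.Bijective (f i)) : V.IsIsomorphic W :=
  ⟨fun i => LinearEquiv.ofBijective (f i) (hb i), mem_Hom.1 hf⟩

theorem exists_inverse_of_bijective {f : ∀ i, V.space i →ₗ[k] W.space i} (hf : f ∈ Hom V W)
    (hb : ∀ i, Function.Bijective (f i)) :
    ∃ g ∈ Hom W V, (∀ i x, g i (f i x) = x) ∧ ∀ i y, f i (g i y) = y := by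
  refine ⟨fun i => (LinearEquiv.ofBijective (f i) (hb i)).symm, mem_Hom.2 fun i j h y => ?_,
    fun i x => (LinearEquiv.ofBijective (f i) (hb i)).symm_apply_apply x,
    fun i y => (LinearEquiv.ofBijective (f i) (hb i)).apply_symm_apply y⟩
  obtain ⟨x, rfl⟩ := (hb i).2 y
  have h1 := (LinearEquiv.ofBijective (f i) (hb i)).symm_apply_apply x
  have h2 := (LinearEquiv.ofBijective (f j) (hb j)).symm_apply_apply (V.map h x)
  simp only [LinearEquiv.ofBijective_apply] at h1 h2
  simp only [LinearEquiv.coe_coe]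
  rw [h1, ← mem_Hom.1 hf, h2]

/-- The vanishing of `Ext¹(V, W)`. -/
def ExtVanishes (V W : QuiverRep.{u, v, w} k I) : Prop :=
  Function.Surjective (coboundary V W)

theorem extVanishes_iff : ExtVanishes V W ↔
    ∀ ξ : ∀ i j : I, (i ⟶ j) → V.space i →ₗ[k] W.space j,
      ∃ f : ∀ i, V.space i →ₗ[k] W.space i, ∀ (i j : I) (h : i ⟶ j) (x : V.space i),
        f j (V.map h x) - W.map h (f i x) = ξ i j h x := by
  refine forall_congr' fun ξ => exists_congr fun f => ⟨?_, fun hf => ?_⟩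
  · rintro rfl i j h x
    rfl
  · ext i j h x
    exact hf i j h x

/-- As the path algebra is hereditary, `Ext¹(X, -)` is right exact. -/
theorem ExtVanishes.of_surjective (hXY : ExtVanishes X Y) {g : ∀ i, Y.space i →ₗ[k] Z.space i}
    (hg : g ∈ Hom Y Z) (hs : ∀ i, Function.Surjective (g i)) : ExtVanishes X Z := by
  rw [extVanishes_iff] at hXY ⊢
  intro ξ
  choose s hs' using fun i =>
    (g i).exists_rightInverse_of_surjective (LinearMap.range_eq_top.2 (hs i))
  obtain ⟨f, hf⟩ := hXY fun i j h => s j ∘ₗ ξ i j h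
  refine ⟨fun i => g i ∘ₗ f i, fun i j h x => ?_⟩
  simp only [LinearMap.comp_apply] at hf ⊢
  rw [← mem_Hom.1 hg, ← map_sub, hf]
  exact LinearMap.congr_fun (hs' j) _

/-- As the path algebra is hereditary, `Ext¹(-, Z)` is right exact. -/
theorem ExtVanishes.of_injective (hYZ : ExtVanishes Y Z) {f : ∀ i, X.space i →ₗ[k] Y.space i}
    (hf : f ∈ Hom X Y) (hi : ∀ i, Function.Injective (f i)) : ExtVanishes X Z := by
  rw [extVanishes_iff] at hYZ ⊢
  intro ξ
  choose s hs using fun i => (f i).exists_leftInverse_of_injective (LinearMap.ker_eq_bot.2 (hi i))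
  obtain ⟨g, hg⟩ := hYZ fun i j h => ξ i j h ∘ₗ s i
  refine ⟨fun i => g i ∘ₗ f i, fun i j h x => ?_⟩
  simp only [LinearMap.comp_apply] at hg ⊢
  rw [mem_Hom.1 hf, hg]
  exact congrArg _ (LinearMap.congr_fun (hs i) x)

/-! ### Subrepresentations -/

/-- A family of subspaces is invariant if it is stable under the maps along the arrows. -/
def IsInvariant (V : QuiverRep.{u, v, w} k I) (p : ∀ i, Submodule k (V.space i)) : Prop :=
  ∀ (i j : I) (h : i ⟶ j), ∀ x ∈ p i, V.map h x ∈ p j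

/-- The subrepresentation on an invariant family of subspaces. -/
def sub (V : QuiverRep.{u, v, w} k I) (p : ∀ i, Submodule k (V.space i)) (hp : V.IsInvariant p) :
    QuiverRep.{u, v, w} k I where
  space i := p i
  map h := (V.map h).restrict (hp _ _ h)

theorem subtype_mem_Hom {p : ∀ i, Submodule k (V.space i)} (hp : V.IsInvariant p) :
    (fun i => (p i).subtype) ∈ Hom (V.sub p hp) V :=
  mem_Hom.2 fun _ _ _ _ => rfl

theorem isInvariant_ker {f : ∀ i, V.space i →ₗ[k] W.space i} (hf : f ∈ Hom V W) :
    V.IsInvariant fun i => LinearMap.ker (f i) := fun i j h x hx => by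
  rw [LinearMap.mem_ker] at hx ⊢
  rw [mem_Hom.1 hf, hx, map_zero]

theorem isInvariant_range {f : ∀ i, V.space i →ₗ[k] W.space i} (hf : f ∈ Hom V W) :
    W.IsInvariant fun i => LinearMap.range (f i) := by
  rintro i j h _ ⟨x, rfl⟩
  exact ⟨V.map h x, mem_Hom.1 hf i j h x⟩

theorem rangeRestrict_mem_Hom {f : ∀ i, V.space i →ₗ[k] W.space i} (hf : f ∈ Hom V W) :
    (fun i => (f i).rangeRestrict) ∈ Hom V (W.sub _ (isInvariant_range hf)) :=
  mem_Hom.2 fun i j h x => Subtype.ext (mem_Hom.1 hf i j h x)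

/-- If `Ext¹(V / p, A) = 0` then every homomorphism `p → A` extends to `V`. The quotient `V / p` is
given as the target of a surjective homomorphism `g` with kernel `p`. -/
theorem exists_extend_of_extVanishes {A : QuiverRep.{u, v, w} k I}
    {p : ∀ i, Submodule k (V.space i)} (hp : V.IsInvariant p)
    {g : ∀ i, V.space i →ₗ[k] W.space i} (hg : g ∈ Hom V W)
    (hs : ∀ i, Function.Surjective (g i)) (hker : ∀ i x, g i x = 0 ↔ x ∈ p i)
    (hext : ExtVanishes W A) {π : ∀ i, p i →ₗ[k] A.space i} (hπ : π ∈ Hom (V.sub p hp) A) :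
    ∃ ρ ∈ Hom V A, ∀ i (x : p i), ρ i x = π i x := by
  choose π' hπ' using fun i => (π i).exists_extend
  have hπ'' : ∀ i (x : p i), π' i x = π i x := fun i x => LinearMap.congr_fun (hπ' i) x
  choose s hs' using fun i =>
    (g i).exists_rightInverse_of_surjective (LinearMap.range_eq_top.2 (hs i))
  have hgs : ∀ i y, g i (s i y) = y := fun i y => LinearMap.congr_fun (hs' i) y
  obtain ⟨f, hf⟩ := extVanishes_iff.1 hext fun i j h => coboundary V A π' i j h ∘ₗ s i
  refine ⟨fun i => π' i - f i ∘ₗ g i, mem_Hom.2 fun i j h x => ?_, fun i x => ?_⟩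
  · have hx : x - s i (g i x) ∈ p i := (hker i _).1 (by rw [map_sub, hgs, sub_self])
    have h1 : π' j (V.map h (x - s i (g i x))) = A.map h (π' i (x - s i (g i x))) := by
      rw [hπ'' i ⟨_, hx⟩, hπ'' j ⟨_, hp i j h _ hx⟩]
      exact mem_Hom.1 hπ i j h ⟨_, hx⟩
    have h2 := hf i j h (g i x)
    simp only [LinearMap.comp_apply, coboundary_apply] at h2
    simp only [LinearMap.sub_apply, LinearMap.comp_apply, map_sub] at h1 ⊢
    rw [mem_Hom.1 hg]
    linear_combination (norm := module) h1 - h2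
  · have : g i x = 0 := (hker i _).2 x.2
    simp [this, hπ'']

/-! ### The Euler form and dimensions -/

theorem IsIsomorphic.dimVector_eq (h : V.IsIsomorphic W) : V.dimVector = W.dimVector := by
  obtain ⟨φ, -⟩ := h
  exact funext fun i => congrArg Nat.cast (φ i).finrank_eq

theorem dimVector_ne_zero [∀ i, FiniteDimensional k (V.space i)] (hV : ¬ V.IsZero) :
    V.dimVector ≠ 0 := fun h => hV fun i =>
  (Module.finrank_zero_iff (R := k)).1 (Int.natCast_eq_zero.1 (congrFun h i))

section Dimension

variable [Fintype I] [∀ i j : I, Finite (i ⟶ j)]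

/-- The Euler form computes `dim Hom - dim Ext¹`. -/
theorem finrank_Hom_eq [∀ i, FiniteDimensional k (V.space i)]
    [∀ i, FiniteDimensional k (W.space i)] : (Module.finrank k (Hom V W) : ℤ) =
      eulerForm V.dimVector W.dimVector +
        Module.finrank k (_ ⧸ LinearMap.range (coboundary V W)) := by
  have : ∀ i j : I, Fintype (i ⟶ j) := fun i j => Fintype.ofFinite _
  have h1 := LinearMap.finrank_range_add_finrank_ker (coboundary V W)
  have h2 := Submodule.finrank_quotient_add_finrank (LinearMap.range (coboundary V W))
  have h3 : Module.finrank k (∀ i, V.space i →ₗ[k] W.space i) =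
      ∑ i, Module.finrank k (V.space i) * Module.finrank k (W.space i) := by
    rw [Module.finrank_pi_fintype]
    simp only [Module.finrank_linearMap]
  have h4 : Module.finrank k (∀ i j : I, (i ⟶ j) → V.space i →ₗ[k] W.space j) =
      ∑ i, ∑ j, Nat.card (i ⟶ j) *
        (Module.finrank k (V.space i) * Module.finrank k (W.space j)) := by
    simp only [Module.finrank_pi_fintype, Module.finrank_linearMap, Finset.sum_const,
      Finset.card_univ, smul_eq_mul, Nat.card_eq_fintype_card]
  rw [h3] at h1
  rw [h4] at h2
  have h1' := congrArg (Nat.cast : ℕ → ℤ) h1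
  have h2' := congrArg (Nat.cast : ℕ → ℤ) h2
  push_cast at h1' h2'
  rw [eulerForm, Hom]
  simp only [dimVector]
  linarith

theorem eulerForm_le_finrank_Hom [∀ i, FiniteDimensional k (V.space i)]
    [∀ i, FiniteDimensional k (W.space i)] :
    eulerForm V.dimVector W.dimVector ≤ Module.finrank k (Hom V W) := by
  rw [finrank_Hom_eq]
  omega

theorem ExtVanishes.eulerForm_eq [∀ i, FiniteDimensional k (V.space i)]
    [∀ i, FiniteDimensional k (W.space i)] (h : ExtVanishes V W) :
    eulerForm V.dimVector W.dimVector = Module.finrank k (Hom V W) := by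
  have : Subsingleton (_ ⧸ LinearMap.range (coboundary V W)) :=
    Submodule.Quotient.subsingleton_iff.2 (LinearMap.range_eq_top.2 h)
  rw [finrank_Hom_eq, Module.finrank_zero_of_subsingleton]
  simp

end Dimension

end QuiverRep

/-! ### Finite-dimensional algebras with few idempotents -/

section Algebra

variable {k : Type*} [Field k]

open Polynomial in
theorem isUnit_or_isNilpotent_of_forall_idempotent {A : Type*} [Ring A] [Algebra k A]
    [FiniteDimensional k A] (hA : ∀ e : A, e * e = e → e = 0 ∨ e = 1) (a : A) :
    IsUnit a ∨ IsNilpotent a := by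
  have hm : minpoly k a ≠ 0 := minpoly.ne_zero (Algebra.IsIntegral.isIntegral a)
  obtain ⟨g, hg, hdvd⟩ := Polynomial.exists_eq_pow_rootMultiplicity_mul_and_not_dvd _ hm 0
  generalize Polynomial.rootMultiplicity 0 (minpoly k a) = n at hg
  rw [map_zero, sub_zero] at hg hdvd
  -- Fitting's idempotent comes from a Bézout identity between the nilpotent part `X ^ n` and the
  -- invertible part `g` of the minimal polynomial.
  obtain ⟨r, s, hrs⟩ : IsCoprime ((X : k[X]) ^ (n + 1)) g :=
    ((Polynomial.irreducible_X.coprime_iff_not_dvd).2 hdvd).pow_left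
  have hmin : aeval a (X ^ n * g : k[X]) = 0 := by rw [← hg, minpoly.aeval]
  have hsum : aeval a (r * X ^ (n + 1)) + aeval a (s * g) = 1 := by
    rw [← map_add, hrs, map_one]
  have hzero : aeval a (r * X ^ (n + 1)) * aeval a (s * g) = 0 := by
    rw [← map_mul, show r * X ^ (n + 1) * (s * g) = (r * X * s) * (X ^ n * g) by ring,
      map_mul (aeval a) (r * X * s), hmin, mul_zero]
  have hidem : aeval a (r * X ^ (n + 1)) * aeval a (r * X ^ (n + 1)) =
      aeval a (r * X ^ (n + 1)) :=
    calc _ = aeval a (r * X ^ (n + 1)) * (aeval a (r * X ^ (n + 1)) + aeval a (s * g)) := by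
          rw [mul_add, hzero, add_zero]
      _ = _ := by rw [hsum, mul_one]
  rcases hA _ hidem with h | h
  · right
    refine ⟨n, ?_⟩
    rw [h, zero_add] at hsum
    calc a ^ n = aeval a (X ^ n : k[X]) * aeval a (s * g) := by
          rw [hsum, mul_one, map_pow, aeval_X]
      _ = aeval a (s * (X ^ n * g)) := by rw [← map_mul]; congr 1; ring
      _ = 0 := by rw [map_mul (aeval a) s, hmin, mul_zero]
  · left
    refine ⟨⟨a, aeval a (r * X ^ n), ?_, ?_⟩, rfl⟩
    · calc a * aeval a (r * X ^ n) = aeval a (X * (r * X ^ n)) := by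
            rw [map_mul (aeval a) X, aeval_X]
        _ = 1 := by rw [← h]; congr 1; ring
    · calc aeval a (r * X ^ n) * a = aeval a (r * X ^ n * X) := by
            rw [map_mul (aeval a) _ X, aeval_X]
        _ = 1 := by rw [← h]; congr 1; ring

theorem finrank_dvd_finrank_of_forall_isUnit {D M : Type*} [Ring D] [Algebra k D] [Nontrivial D]
    (hD : ∀ a : D, IsUnit a ∨ a = 0) [AddCommGroup M] [Module k M] [Module D M]
    [IsScalarTower k D M] : Module.finrank k D ∣ Module.finrank k M := by
  let : DivisionRing D := DivisionRing.ofIsUnitOrEqZero hD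
  exact Dvd.intro _ (Module.finrank_mul_finrank k D M)

end Algebra

namespace QuiverRep

variable {k : Type u} [Field k] {I : Type v} [Quiver.{w} I] {U V W X Y Z : QuiverRep.{u, v, w} k I}

/-! ### Indecomposable representations -/

/-- The endomorphism algebra of a representation. -/
def endAlgebra (V : QuiverRep.{u, v, w} k I) : Subalgebra k (∀ i, Module.End k (V.space i)) where
  carrier := Hom V V
  mul_mem' hf hg := comp_mem_Hom hf hg
  add_mem' hf hg := (Hom V V).add_mem hf hg
  algebraMap_mem' c := mem_Hom.2 fun i j h x => by simp

theorem IsIndecomposable.eq_zero_or_eq_id (hV : V.IsIndecomposable)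
    {e : ∀ i, V.space i →ₗ[k] V.space i} (he : e ∈ Hom V V) (hee : ∀ i x, e i (e i x) = e i x) :
    (∀ i x, e i x = 0) ∨ ∀ i x, e i x = x := by
  by_contra! hcon
  obtain ⟨⟨i, x, hx⟩, j, y, hy⟩ := hcon
  refine hV.2 ⟨V.sub _ (isInvariant_range he), V.sub _ (isInvariant_ker he), fun h => ?_,
    fun h => ?_, ?_⟩
  · exact hx (congrArg Subtype.val ((h i).elim ⟨e i x, x, rfl⟩ 0))
  · have hk : y - e j y ∈ LinearMap.ker (e j) := by
      rw [LinearMap.mem_ker, map_sub, hee, sub_self]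
    have : y - e j y = 0 := congrArg Subtype.val ((h j).elim ⟨_, hk⟩ 0)
    exact hy (sub_eq_zero.1 this).symm
  · refine isIsomorphic_of_bijective (f := fun i => (e i).rangeRestrict.prod
      ((LinearMap.id - e i).codRestrict (LinearMap.ker (e i)) fun x => by
        simp [hee])) (mem_Hom.2 fun i j h x => ?_) fun i => ⟨?_, ?_⟩
    · refine Prod.ext (Subtype.ext (mem_Hom.1 he i j h x)) (Subtype.ext ?_)
      change V.map h x - e j (V.map h x) = V.map h (x - e i x)
      rw [mem_Hom.1 he, map_sub]
    · intro x y hxy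
      have h1 : e i x = e i y := congrArg (fun z => (Prod.fst z).1) hxy
      have h2 : x - e i x = y - e i y := congrArg (fun z => (Prod.snd z).1) hxy
      rw [h1] at h2
      exact sub_left_injective h2
    · rintro ⟨⟨_, x, rfl⟩, y, hy⟩
      rw [LinearMap.mem_ker] at hy
      refine ⟨e i x + y, Prod.ext (Subtype.ext ?_) (Subtype.ext ?_)⟩
      · change e i (e i x + y) = e i x
        rw [map_add, hy, hee, add_zero]
      · change e i x + y - e i (e i x + y) = y
        rw [map_add, hy, hee]
        abel

/-- A form of Fitting's lemma. -/
theorem IsIndecomposable.bijective_or_isNilpotent [Finite I] (hV : V.IsIndecomposable)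
    [∀ i, FiniteDimensional k (V.space i)] {θ : ∀ i, Module.End k (V.space i)}
    (hθ : θ ∈ Hom V V) : (∀ i, Function.Bijective (θ i)) ∨ IsNilpotent θ := by
  have hidem : ∀ e : V.endAlgebra, e * e = e → e = 0 ∨ e = 1 := fun e he => by
    rcases hV.eq_zero_or_eq_id e.2 fun i x =>
      LinearMap.congr_fun (congrFun (congrArg Subtype.val he) i) x with h | h
    · exact Or.inl (Subtype.ext (funext fun i => LinearMap.ext (h i)))
    · exact Or.inr (Subtype.ext (funext fun i => LinearMap.ext (h i)))
  have : FiniteDimensional k V.endAlgebra :=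
    inferInstanceAs (FiniteDimensional k (Subalgebra.toSubmodule V.endAlgebra))
  rcases isUnit_or_isNilpotent_of_forall_idempotent (k := k) hidem ⟨θ, hθ⟩ with h | h
  · refine Or.inl fun i => ?_
    have h1 := (h.map V.endAlgebra.val).map (Pi.evalRingHom (fun i => Module.End k (V.space i)) i)
    exact (Module.End.isUnit_iff _).1 h1
  · exact Or.inr (h.map V.endAlgebra.val)

/-- The sum of the dimensions of the spaces of a representation. -/
noncomputable def totalDim [Fintype I] (V : QuiverRep.{u, v, w} k I) : ℕ :=
  ∑ i, Module.finrank k (V.space i)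

theorem directSum_comm (V W : QuiverRep.{u, v, w} k I) :
    (V.directSum W).IsIsomorphic (W.directSum V) :=
  ⟨fun _ => LinearEquiv.prodComm k _ _, fun _ _ _ _ => rfl⟩

theorem finiteDimensional_of_isIsomorphic_directSum (h : U.IsIsomorphic (V.directSum W))
    [∀ i, FiniteDimensional k (U.space i)] (i : I) : FiniteDimensional k (V.space i) := by
  obtain ⟨φ, -⟩ := h
  exact Module.Finite.of_surjective (LinearMap.fst k (V.space i) (W.space i) ∘ₗ (φ i).toLinearMap)
    ((Prod.fst_surjective (α := V.space i) (β := W.space i)).comp (φ i).surjective)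

theorem dimVector_directSum [∀ i, FiniteDimensional k (V.space i)]
    [∀ i, FiniteDimensional k (W.space i)] :
    (V.directSum W).dimVector = V.dimVector + W.dimVector :=
  funext fun i => by
    have : Module.finrank k ((V.directSum W).space i) = _ :=
      Module.finrank_prod (R := k) (M := V.space i) (M' := W.space i)
    simp only [dimVector, Pi.add_apply, this]
    push_cast
    rfl

theorem totalDim_lt_of_isIsomorphic_directSum [Fintype I] (h : U.IsIsomorphic (V.directSum W))
    [∀ i, FiniteDimensional k (U.space i)] (hW : ¬ W.IsZero) : V.totalDim < U.totalDim := by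
  have := finiteDimensional_of_isIsomorphic_directSum h
  have := finiteDimensional_of_isIsomorphic_directSum (h.trans (directSum_comm V W))
  have hle : ∀ i, 0 ≤ W.dimVector i := fun i => Int.natCast_nonneg _
  obtain ⟨i, hi⟩ := Function.ne_iff.1 (dimVector_ne_zero hW)
  have h1 : ∀ i, (Module.finrank k (U.space i) : ℤ) = Module.finrank k (V.space i) +
      W.dimVector i := fun i =>
    (congrFun h.dimVector_eq i).trans (congrFun dimVector_directSum i)
  refine Finset.sum_lt_sum (fun j _ => ?_) ⟨i, Finset.mem_univ i, ?_⟩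
  · have := h1 j
    have := hle j
    omega
  · have := h1 i
    have := hle i
    have : W.dimVector i ≠ 0 := hi
    omega

/-- A nonzero vector of a finite-dimensional representation has a nonzero component in some
indecomposable direct summand. -/
theorem exists_indecomposable_summand [Fintype I] (U : QuiverRep.{u, v, w} k I)
    [∀ i, FiniteDimensional k (U.space i)] {i : I} {u : U.space i} (hu : u ≠ 0) :
    ∃ A : QuiverRep.{u, v, w} k I, A.IsIndecomposable ∧ A.IsFiniteDimensional ∧
      ∃ ι ∈ Hom A U, ∃ π ∈ Hom U A, (∀ j x, π j (ι j x) = x) ∧ π i u ≠ 0 := by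
  induction hn : U.totalDim using Nat.strong_induction_on generalizing U with
  | _ n ih =>
  subst hn
  by_cases hU : U.IsIndecomposable
  · exact ⟨U, hU, fun _ => inferInstance, _, id_mem_Hom, _, id_mem_Hom, fun _ _ => rfl, hu⟩
  have hU0 : ¬ U.IsZero := fun h => hu ((h i).elim _ _)
  obtain ⟨V₁, V₂, h₁, h₂, hiso⟩ : ∃ V₁ V₂ : QuiverRep.{u, v, w} k I,
      ¬ V₁.IsZero ∧ ¬ V₂.IsZero ∧ U.IsIsomorphic (V₁.directSum V₂) := by
    by_contra h
    exact hU ⟨hU0, h⟩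
  have key : ∀ V W : QuiverRep.{u, v, w} k I, ¬ W.IsZero →
      ∀ φ : ∀ i, U.space i ≃ₗ[k] (V.directSum W).space i,
      (∀ (i j : I) (h : i ⟶ j) (x : U.space i),
        φ j (U.map h x) = (V.directSum W).map h (φ i x)) →
      Prod.fst (φ i u) ≠ 0 → ∃ A : QuiverRep.{u, v, w} k I, A.IsIndecomposable ∧
        A.IsFiniteDimensional ∧ ∃ ι ∈ Hom A U, ∃ π ∈ Hom U A,
          (∀ j x, π j (ι j x) = x) ∧ π i u ≠ 0 := by
    intro V W hW φ hφ hne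
    have hVW : U.IsIsomorphic (V.directSum W) := ⟨φ, hφ⟩
    have := finiteDimensional_of_isIsomorphic_directSum hVW
    obtain ⟨A, hA, hA', ι, hι, π, hπ, hπι, hπu⟩ :=
      ih _ (totalDim_lt_of_isIsomorphic_directSum hVW hW) V hne rfl
    have hfst : (fun j => LinearMap.fst k (V.space j) (W.space j) ∘ₗ (φ j).toLinearMap) ∈ Hom U V :=
      mem_Hom.2 fun i j h x => congrArg Prod.fst (hφ i j h x)
    have hinl : (fun j => (φ j).symm.toLinearMap ∘ₗ LinearMap.inl k (V.space j) (W.space j)) ∈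
        Hom V U := mem_Hom.2 fun i j h x => by
      refine (φ j).injective ?_
      refine ((φ j).apply_symm_apply _).trans ((hφ i j h _).trans ?_).symm
      refine (congrArg ((V.directSum W).map h) ((φ i).apply_symm_apply _)).trans ?_
      exact Prod.ext rfl (map_zero (W.map h))
    refine ⟨A, hA, hA', _, comp_mem_Hom hinl hι, _, comp_mem_Hom hπ hfst, fun j x => ?_, hπu⟩
    refine (congrArg (fun z => π j (Prod.fst z)) ((φ j).apply_symm_apply _)).trans ?_
    exact hπι j x
  obtain ⟨φ, hφ⟩ := hiso
  by_cases hne : Prod.fst (φ i u) = 0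
  · refine key V₂ V₁ h₁ (fun i => (φ i).trans (LinearEquiv.prodComm k _ _))
      (fun i j h x => congrArg Prod.swap (hφ i j h x)) fun hne' => hu ((φ i).injective ?_)
    rw [map_zero]
    exact Prod.ext hne hne'
  · exact key V₁ V₂ h₂ φ hφ hne

end QuiverRep

namespace QuiverRep

variable {k : Type u} [Field k] {I : Type v} [Quiver.{w} I] {U V W X Y Z : QuiverRep.{u, v, w} k I}

/-! ### Bricks -/

/-- Every nonzero endomorphism is invertible. -/
def IsBrick (V : QuiverRep.{u, v, w} k I) : Prop :=
  ∀ f ∈ Hom V V, f ≠ 0 → ∀ i, Function.Bijective (f i)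

section

variable [Fintype I]

/-- Any square-zero endomorphism `θ ≠ 0` of minimal rank of an indecomposable representation yields
an indecomposable representation of smaller dimension, a summand of `ker θ`, which has nontrivial
self-extensions. -/
theorem exists_not_extVanishes_of_sq_zero (hV : V.IsIndecomposable)
    [∀ i, FiniteDimensional k (V.space i)] {θ : ∀ i, V.space i →ₗ[k] V.space i}
    (hθ : θ ∈ Hom V V) (hθ0 : θ ≠ 0) (hθ2 : ∀ i x, θ i (θ i x) = 0)
    (hmin : ∀ φ ∈ Hom V V, φ ≠ 0 → (∀ i x, φ i (φ i x) = 0) →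
      ∑ i, Module.finrank k (LinearMap.range (θ i)) ≤
        ∑ i, Module.finrank k (LinearMap.range (φ i))) :
    ∃ A : QuiverRep.{u, v, w} k I, A.IsIndecomposable ∧ A.IsFiniteDimensional ∧
      A.totalDim < V.totalDim ∧ ¬ ExtVanishes A A := by
  obtain ⟨i, hi⟩ := Function.ne_iff.1 hθ0
  obtain ⟨x, hx⟩ : ∃ x, θ i x ≠ 0 := by
    by_contra! h
    exact hi (LinearMap.ext h)
  have hK := isInvariant_ker hθ
  have hKfin : ∀ i, FiniteDimensional k ((V.sub _ hK).space i) := fun i =>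
    inferInstanceAs (FiniteDimensional k (LinearMap.ker (θ i)))
  have hu : (⟨θ i x, hθ2 i x⟩ : (V.sub _ hK).space i) ≠ 0 := fun h => hx (congrArg Subtype.val h)
  obtain ⟨A, hA, hAfin, ι, hι, π, hπ, hπι, hπu⟩ :=
    exists_indecomposable_summand (V.sub _ hK) (i := i)
      (u := (⟨θ i x, hθ2 i x⟩ : (V.sub _ hK).space i)) hu
  have hιinj : ∀ j, Function.Injective (ι j) := fun j => Function.LeftInverse.injective (hπι j)
  have hAfin' : ∀ i, FiniteDimensional k (A.space i) := hAfin
  have hιV := comp_mem_Hom (subtype_mem_Hom hK) hι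
  have hιker : ∀ j a, θ j ((ι j a).1) = 0 := fun j a => (ι j a).2
  -- the inclusion of the image of `θ` in its kernel, followed by the projection to `A`
  have hIK : (fun j => (LinearMap.range (θ j)).subtype.codRestrict (LinearMap.ker (θ j))
      (by rintro ⟨_, y, rfl⟩; exact hθ2 j y)) ∈
        Hom (V.sub _ (isInvariant_range hθ)) (V.sub _ hK) := mem_Hom.2 fun _ _ _ _ => rfl
  have hIA := comp_mem_Hom hπ hIK
  set σ := fun j => π j ∘ₗ ((LinearMap.range (θ j)).subtype.codRestrict (LinearMap.ker (θ j))
      (by rintro ⟨_, y, rfl⟩; exact hθ2 j y)) with hσ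
  have hφ := comp_mem_Hom hιV (comp_mem_Hom hIA (rangeRestrict_mem_Hom hθ))
  set φ : ∀ j, V.space j →ₗ[k] V.space j := fun j =>
    ((LinearMap.ker (θ j)).subtype ∘ₗ ι j) ∘ₗ (σ j ∘ₗ (θ j).rangeRestrict) with hφdef
  have hφ0 : φ ≠ 0 := fun h => by
    have h1 : φ i x = 0 := by rw [h]; rfl
    exact hπu (hιinj i (Subtype.ext (h1.trans (congrArg Subtype.val (map_zero (ι i))).symm)))
  have hφ2 : ∀ j y, φ j (φ j y) = 0 := fun j y => by
    have h1 : (θ j).rangeRestrict (φ j y) = 0 := Subtype.ext (hιker j _)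
    change ((LinearMap.ker (θ j)).subtype ∘ₗ ι j) (σ j ((θ j).rangeRestrict (φ j y))) = 0
    rw [h1, map_zero, map_zero]
  have hrange : ∀ j, LinearMap.range (φ j) =
      (LinearMap.range (σ j)).map ((LinearMap.ker (θ j)).subtype ∘ₗ ι j) := fun j => by
    rw [← LinearMap.range_comp, hφdef]
    exact LinearMap.range_comp_of_range_eq_top (((LinearMap.ker (θ j)).subtype ∘ₗ ι j) ∘ₗ σ j)
      (LinearMap.range_rangeRestrict _)
  have hrank : ∀ j, Module.finrank k (LinearMap.range (φ j)) ≤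
      Module.finrank k (LinearMap.range (σ j)) := fun j => by
    rw [hrange]
    exact Submodule.finrank_map_le _ _
  -- by minimality of the rank of `θ`, that composition is injective
  have hσinj : ∀ j, Function.Injective (σ j) := by
    have hle : ∀ j, Module.finrank k (LinearMap.range (σ j)) ≤
        Module.finrank k (LinearMap.range (θ j)) := fun j => LinearMap.finrank_range_le _
    have hsum := (hmin φ hφ hφ0 hφ2).trans (Finset.sum_le_sum fun j _ => hrank j)
    have heq := (Finset.sum_eq_sum_iff_of_le fun j _ => hle j).1
      (le_antisymm (Finset.sum_le_sum fun j _ => hle j) hsum)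
    intro j
    have h1 := LinearMap.finrank_range_add_finrank_ker (σ j)
    have h2 := heq j (Finset.mem_univ j)
    have h3 : Module.finrank k (LinearMap.ker (σ j)) = 0 := by
      change _ = Module.finrank k (LinearMap.range (θ j)) at h1
      omega
    exact LinearMap.ker_eq_bot.1 (Submodule.finrank_eq_zero.1 h3)
  refine ⟨A, hA, hAfin, ?_, fun hext => ?_⟩
  · have hle : ∀ j, Module.finrank k (A.space j) ≤ Module.finrank k (LinearMap.ker (θ j)) :=
      fun j => LinearMap.finrank_le_finrank_of_injective (hιinj j)
    have hadd := fun j => LinearMap.finrank_range_add_finrank_ker (θ j)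
    refine Finset.sum_lt_sum (fun j _ => ?_) ⟨i, Finset.mem_univ i, ?_⟩
    · have := hle j
      have := hadd j
      omega
    · have := hle i
      have := hadd i
      have : Module.finrank k (LinearMap.range (θ i)) ≠ 0 := fun h =>
        hi (LinearMap.range_eq_bot.1 (Submodule.finrank_eq_zero.1 h))
      omega
  · -- otherwise the projection to `A` extends to `V`, and `A` is a direct summand of `V`
    obtain ⟨ρ, hρ, hρπ⟩ := exists_extend_of_extVanishes hK (rangeRestrict_mem_Hom hθ)
      (fun j => (θ j).surjective_rangeRestrict) (fun j y => Subtype.ext_iff.trans Iff.rfl)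
      (hext.of_injective hIA hσinj) hπ
    have hρι : ∀ j a, ρ j (ι j a).1 = a := fun j a => (hρπ j _).trans (hπι j a)
    rcases hV.eq_zero_or_eq_id (comp_mem_Hom hιV hρ) (fun j y =>
      congrArg (fun a => (ι j a).1) (hρι j (ρ j y))) with h | h
    · have h1 : (ι i (ρ i (θ i x))).1 = 0 := h i (θ i x)
      rw [hρπ i ⟨θ i x, hθ2 i x⟩] at h1
      exact hπu (hιinj i (Subtype.ext (h1.trans (congrArg Subtype.val (map_zero (ι i))).symm)))
    · exact hx ((congrArg (θ i) (h i x)).symm.trans (hιker i _))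

variable [∀ i j : I, Finite (i ⟶ j)]

/-- If `V` is a brick, then `Ext¹(V, V)` is a vector space over the division algebra `End(V)`, so
that its dimension is at least that of `End(V)` as soon as it is nonzero. -/
theorem IsBrick.eulerForm_nonpos_of_not_extVanishes (hV : V.IsBrick)
    [∀ i, FiniteDimensional k (V.space i)] (hext : ¬ ExtVanishes V V) :
    eulerForm V.dimVector V.dimVector ≤ 0 := by
  obtain ⟨ξ, hξ⟩ : ∃ ξ, ξ ∉ LinearMap.range (coboundary V V) := by
    by_contra! h
    exact hext fun ξ => h ξ
  let L : (∀ i, V.space i →ₗ[k] V.space i) →ₗ[k]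
      (∀ i j : I, (i ⟶ j) → V.space i →ₗ[k] V.space j) :=
    { toFun f i j h := f j ∘ₗ ξ i j h
      map_add' _ _ := rfl
      map_smul' _ _ := rfl }
  have hinj : Function.Injective
      (((LinearMap.range (coboundary V V)).mkQ ∘ₗ L) ∘ₗ (Hom V V).subtype) := by
    refine (injective_iff_map_eq_zero _).2 fun f hf => ?_
    by_contra hf0
    obtain ⟨g, hg, hgf, -⟩ := exists_inverse_of_bijective f.2
      (hV f.1 f.2 fun h => hf0 (Subtype.ext h))
    obtain ⟨c, hc⟩ := (Submodule.Quotient.mk_eq_zero _).1 hf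
    refine hξ ⟨fun i => g i ∘ₗ c i, ?_⟩
    ext i j h x
    have h1 : c j (V.map h x) - V.map h (c i x) = f.1 j (ξ i j h x) :=
      LinearMap.congr_fun (congrFun (congrFun (congrFun hc i) j) h) x
    have h2 := congrArg (g j) h1
    rw [hgf, map_sub, mem_Hom.1 hg] at h2
    exact h2
  have : ∀ i j : I, Fintype (i ⟶ j) := fun i j => Fintype.ofFinite _
  have h1 := LinearMap.finrank_le_finrank_of_injective hinj
  have h2 := finrank_Hom_eq (V := V) (W := V)
  omega

/-- If the Euler form is positive definite, indecomposable representations are bricks. -/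
theorem IsIndecomposable.isBrick (hpos : ∀ x : I → ℤ, x ≠ 0 → 0 < eulerForm x x)
    (hV : V.IsIndecomposable) [∀ i, FiniteDimensional k (V.space i)] : V.IsBrick := by
  induction hn : V.totalDim using Nat.strong_induction_on generalizing V with
  | _ n ih =>
  subst hn
  by_contra hnot
  obtain ⟨f, hf, hf0, hfb⟩ : ∃ f ∈ Hom V V, f ≠ 0 ∧ ¬ ∀ i, Function.Bijective (f i) := by
    by_contra! h
    exact hnot h
  have hnil := (hV.bijective_or_isNilpotent hf).resolve_left hfb
  -- the last nonzero power of a nilpotent endomorphism has square zero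
  have hpow : ∀ m, (f : ∀ i, Module.End k (V.space i)) ^ m ∈ Hom V V := fun m =>
    V.endAlgebra.pow_mem hf m
  have hex : ∃ r : ℕ, ∃ θ ∈ Hom V V, θ ≠ 0 ∧ (∀ i x, θ i (θ i x) = 0) ∧
      ∑ i, Module.finrank k (LinearMap.range (θ i)) = r := by
    classical
    set m := Nat.find hnil with hm
    have hm0 := Nat.find_spec hnil
    have hm1 : 1 < m := by
      by_contra! hle
      have : (f : ∀ i, Module.End k (V.space i)) ^ 1 = 0 := pow_eq_zero_of_le hle hm0
      exact hf0 (by rwa [pow_one] at this)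
    refine ⟨_, _, hpow (m - 1), Nat.find_min hnil (m := m - 1) (by omega), fun i x => ?_, rfl⟩
    have : (f : ∀ i, Module.End k (V.space i)) ^ (m - 1) * f ^ (m - 1) = 0 := by
      rw [← pow_add]
      exact pow_eq_zero_of_le (by omega) hm0
    exact LinearMap.congr_fun (congrFun this i) x
  classical
  obtain ⟨θ, hθ, hθ0, hθ2, hr⟩ := Nat.find_spec hex
  obtain ⟨A, hA, hAfin, hlt, hext⟩ := exists_not_extVanishes_of_sq_zero hV hθ hθ0 hθ2
    fun φ hφ hφ0 hφ2 => hr.le.trans (Nat.find_min' hex ⟨φ, hφ, hφ0, hφ2, rfl⟩)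
  have hAfin' : ∀ i, FiniteDimensional k (A.space i) := hAfin
  exact ((ih _ hlt hA rfl).eulerForm_nonpos_of_not_extVanishes hext).not_gt
    (hpos _ (dimVector_ne_zero hA.1))

theorem IsIndecomposable.extVanishes (hpos : ∀ x : I → ℤ, x ≠ 0 → 0 < eulerForm x x)
    (hV : V.IsIndecomposable) [∀ i, FiniteDimensional k (V.space i)] : ExtVanishes V V := by
  by_contra h
  exact ((hV.isBrick hpos).eulerForm_nonpos_of_not_extVanishes h).not_gt
    (hpos _ (dimVector_ne_zero hV.1))

/-- The dimension `d` of the division algebra `End(V)` divides the dimension vector, and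
`d = ⟨dim V, dim V⟩`. Hence `d ^ 2 ∣ d`, which forces `d = 1`. -/
theorem IsIndecomposable.eulerForm_eq_one (hpos : ∀ x : I → ℤ, x ≠ 0 → 0 < eulerForm x x)
    (hV : V.IsIndecomposable) [∀ i, FiniteDimensional k (V.space i)] :
    eulerForm V.dimVector V.dimVector = 1 := by
  have hpos' := hpos _ (dimVector_ne_zero hV.1)
  have hunit : ∀ a : V.endAlgebra, IsUnit a ∨ a = 0 := fun a => by
    by_cases ha : a = 0
    · exact Or.inr ha
    · obtain ⟨g, hg, h1, h2⟩ := exists_inverse_of_bijective a.2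
        (hV.isBrick hpos a.1 a.2 fun h => ha (Subtype.ext h))
      exact Or.inl ⟨⟨a, ⟨g, hg⟩, Subtype.ext (funext fun i => LinearMap.ext (h2 i)),
        Subtype.ext (funext fun i => LinearMap.ext (h1 i))⟩, rfl⟩
  have hd := (hV.extVanishes hpos).eulerForm_eq
  have hd' : Module.finrank k V.endAlgebra = Module.finrank k (Hom V V) := rfl
  rw [← hd'] at hd
  have : Nontrivial V.endAlgebra :=
    Module.nontrivial_of_finrank_pos (R := k) (by omega)
  have hdvd : ∀ i, Module.finrank k V.endAlgebra ∣ Module.finrank k (V.space i) := fun i => by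
    let : Module V.endAlgebra (V.space i) := Module.compHom (V.space i)
      ((Pi.evalRingHom (fun i => Module.End k (V.space i)) i).comp V.endAlgebra.val.toRingHom)
    have : IsScalarTower k V.endAlgebra (V.space i) := ⟨fun _ _ _ => rfl⟩
    exact finrank_dvd_finrank_of_forall_isUnit hunit
  choose y hy using hdvd
  set d := Module.finrank k V.endAlgebra
  have hV' : V.dimVector = (d : ℤ) • fun i => (y i : ℤ) := funext fun i => by
    simp [dimVector, hy i]
  have hd2 : (d : ℤ) * (d * eulerForm (fun i => (y i : ℤ)) fun i => (y i : ℤ)) = d := by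
    rw [← hd]
    conv_rhs => rw [hV', eulerForm_smul_smul]
    rw [hd]
    ring
  have hd3 := mul_left_cancel₀ (by omega) (hd2.trans (mul_one (d : ℤ)).symm)
  rw [hd]
  exact Int.eq_one_of_mul_eq_one_right (by omega) hd3

/-- Indecomposable representations are determined by their dimension vectors: if `f : X → Y` is a
nonzero homomorphism with image `J`, then `⟨dim Y, dim J⟩ = ⟨dim X, dim J⟩ = dim Hom(X, J) > 0`, and
a nonzero homomorphism `Y → J ⊆ Y` must be surjective. -/
theorem IsIndecomposable.isIsomorphic_of_dimVector_eq
    (hpos : ∀ x : I → ℤ, x ≠ 0 → 0 < eulerForm x x)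
    (hX : X.IsIndecomposable) [∀ i, FiniteDimensional k (X.space i)]
    (hY : Y.IsIndecomposable) [∀ i, FiniteDimensional k (Y.space i)]
    (hXY : X.dimVector = Y.dimVector) : X.IsIsomorphic Y := by
  have exists_ne : ∀ V W : QuiverRep.{u, v, w} k I, 0 < Module.finrank k (Hom V W) →
      ∃ f ∈ Hom V W, f ≠ 0 := fun V W h => by
    have := Module.nontrivial_of_finrank_pos h
    obtain ⟨f, hf⟩ := exists_ne (0 : Hom V W)
    exact ⟨f.1, f.2, fun h => hf (Subtype.ext h)⟩
  have h1 : 0 < Module.finrank k (Hom X Y) := by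
    have h2 := eulerForm_le_finrank_Hom (V := X) (W := Y)
    have h3 := hpos _ (dimVector_ne_zero hX.1)
    rw [← hXY] at h2
    omega
  obtain ⟨f, hf, hf0⟩ := exists_ne _ _ h1
  have hJ := isInvariant_range hf
  have hJfin : ∀ i, FiniteDimensional k ((Y.sub _ hJ).space i) := fun i =>
    inferInstanceAs (FiniteDimensional k (LinearMap.range (f i)))
  have hfJ := rangeRestrict_mem_Hom hf
  have hext : ExtVanishes X (Y.sub _ hJ) :=
    (hX.extVanishes hpos).of_surjective hfJ fun j => (f j).surjective_rangeRestrict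
  have hne : (⟨_, hfJ⟩ : Hom X (Y.sub _ hJ)) ≠ 0 := fun h => hf0 <| funext fun i =>
    LinearMap.ext fun x => congrArg (fun g => ((g.1 i x : LinearMap.range (f i)) : Y.space i)) h
  have : Nontrivial (Hom X (Y.sub _ hJ)) := nontrivial_of_ne _ _ hne
  have h4 : 0 < Module.finrank k (Hom X (Y.sub _ hJ)) := Module.finrank_pos
  have h5 := hext.eulerForm_eq
  have h6 := eulerForm_le_finrank_Hom (V := Y) (W := Y.sub _ hJ)
  rw [← hXY] at h6
  obtain ⟨g, hg, hg0⟩ := exists_ne Y (Y.sub _ hJ) (by omega)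
  have hb := hY.isBrick hpos _ (comp_mem_Hom (subtype_mem_Hom hJ) hg) fun h => hg0 <|
    funext fun i => LinearMap.ext fun x => Subtype.ext (LinearMap.congr_fun (congrFun h i) x)
  have hsurj : ∀ i, Function.Surjective (f i) := fun i y => by
    obtain ⟨x, hx⟩ := (hb i).2 y
    obtain ⟨z, hz⟩ := (g i x).2
    exact ⟨z, hz.trans hx⟩
  refine isIsomorphic_of_bijective hf fun i => ⟨?_, hsurj i⟩
  exact (LinearMap.injective_iff_surjective_of_finrank_eq_finrank
    (Int.natCast_inj.1 (congrFun hXY i))).2 (hsurj i)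

end

end QuiverRep

namespace QuiverRep

variable {k : Type u} [Field k] {I : Type v} [Quiver.{w} I] {U V W X Y Z : QuiverRep.{u, v, w} k I}

/-! ### Extensions and the dimension of the endomorphism algebra -/

/-- The extension of `V` by `U` given by the cocycle `ξ`. -/
abbrev extension (U V : QuiverRep.{u, v, w} k I)
    (ξ : ∀ i j : I, (i ⟶ j) → V.space i →ₗ[k] U.space j) : QuiverRep.{u, v, w} k I where
  space i := U.space i × V.space i
  map {i j} h := (U.map h).coprod (ξ i j h) |>.prod (V.map h ∘ₗ LinearMap.snd k _ _)

section Extension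

variable (ξ : ∀ i j : I, (i ⟶ j) → V.space i →ₗ[k] U.space j)

theorem mem_Hom_extension_left {f : ∀ i, U.space i × V.space i →ₗ[k] Z.space i} :
    f ∈ Hom (extension U V ξ) Z ↔ ∀ (i j : I) (h : i ⟶ j) (x : U.space i × V.space i),
      f j (U.map h x.1 + ξ i j h x.2, V.map h x.2) = Z.map h (f i x) :=
  mem_Hom

theorem mem_Hom_extension_right {f : ∀ i, Z.space i →ₗ[k] U.space i × V.space i} :
    f ∈ Hom Z (extension U V ξ) ↔ ∀ (i j : I) (h : i ⟶ j) (x : Z.space i),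
      f j (Z.map h x) = (U.map h (f i x).1 + ξ i j h (f i x).2, V.map h (f i x).2) :=
  mem_Hom

/-- The restriction of homomorphisms from an extension of `V` by `U` to `U`. -/
def restrictExtension (Z : QuiverRep.{u, v, w} k I) : Hom (extension U V ξ) Z →ₗ[k] Hom U Z where
  toFun f := ⟨fun i => f.1 i ∘ₗ LinearMap.inl k (U.space i) (V.space i), mem_Hom.2 fun i j h x => by
    have := (mem_Hom_extension_left ξ).1 f.2 i j h (x, 0)
    rwa [map_zero, add_zero, map_zero] at this⟩
  map_add' _ _ := rfl
  map_smul' _ _ := rfl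

/-- The composition of homomorphisms to an extension of `V` by `U` with the projection to `V`. -/
def projectExtension (Z : QuiverRep.{u, v, w} k I) : Hom Z (extension U V ξ) →ₗ[k] Hom Z V where
  toFun f := ⟨fun i => LinearMap.snd k (U.space i) (V.space i) ∘ₗ f.1 i, mem_Hom.2 fun i j h x =>
    congrArg Prod.snd ((mem_Hom_extension_right ξ).1 f.2 i j h x)⟩
  map_add' _ _ := rfl
  map_smul' _ _ := rfl

variable [Finite I] [∀ i, FiniteDimensional k (V.space i)]
  [∀ i, FiniteDimensional k (Z.space i)]

theorem finrank_ker_restrictExtension_le :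
    Module.finrank k (LinearMap.ker (restrictExtension ξ Z)) ≤ Module.finrank k (Hom V Z) := by
  have hzero : ∀ (f : LinearMap.ker (restrictExtension ξ Z)) (i : I) (x : U.space i),
      f.1.1 i (x, 0) = 0 := fun f i x =>
    congrArg (fun g : Hom U Z => g.1 i x) (LinearMap.mem_ker.1 f.2)
  have hsplit : ∀ (f : LinearMap.ker (restrictExtension ξ Z)) (i : I)
      (x : U.space i × V.space i), f.1.1 i x = f.1.1 i (0, x.2) := fun f i x => by
    have h : x = ((x.1, 0) + (0, x.2) : U.space i × V.space i) := by simp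
    calc f.1.1 i x = f.1.1 i ((x.1, 0) + (0, x.2) : U.space i × V.space i) := congrArg _ h
      _ = f.1.1 i (x.1, 0) + f.1.1 i (0, x.2) := map_add (f.1.1 i) _ _
      _ = _ := by rw [hzero, zero_add]
  let s : LinearMap.ker (restrictExtension ξ Z) →ₗ[k] Hom V Z :=
    { toFun f := ⟨fun i => f.1.1 i ∘ₗ LinearMap.inr k (U.space i) (V.space i),
        mem_Hom.2 fun i j h x => by
          have h1 := (mem_Hom_extension_left ξ).1 f.1.2 i j h (0, x)
          exact (hsplit f j _).symm.trans h1⟩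
      map_add' _ _ := rfl
      map_smul' _ _ := rfl }
  refine LinearMap.finrank_le_finrank_of_injective (f := s)
    fun f f' hf => ?_
  refine Subtype.ext (Subtype.ext (funext fun i => LinearMap.ext fun x => ?_))
  exact (hsplit f i x).trans ((congrArg (fun g : Hom V Z => g.1 i x.2) hf).trans
    (hsplit f' i x).symm)

variable [∀ i, FiniteDimensional k (U.space i)]

instance (i : I) : FiniteDimensional k ((extension U V ξ).space i) :=
  inferInstanceAs (FiniteDimensional k (U.space i × V.space i))

theorem finrank_Hom_extension_left_le : Module.finrank k (Hom (extension U V ξ) Z) ≤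
    Module.finrank k (Hom U Z) + Module.finrank k (Hom V Z) := by
  have h1 := LinearMap.finrank_range_add_finrank_ker (restrictExtension ξ Z)
  have h2 := Submodule.finrank_le (LinearMap.range (restrictExtension ξ Z))
  have h3 := finrank_ker_restrictExtension_le ξ (Z := Z)
  omega

/-- If the extension does not split, the identity of `U` does not extend to it. -/
theorem finrank_Hom_extension_lt (hξ : ξ ∉ LinearMap.range (coboundary V U)) :
    Module.finrank k (Hom (extension U V ξ) U) <
      Module.finrank k (Hom U U) + Module.finrank k (Hom V U) := by
  have h1 := LinearMap.finrank_range_add_finrank_ker (restrictExtension ξ U)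
  have h3 := finrank_ker_restrictExtension_le ξ (Z := U)
  suffices h2 : Module.finrank k (LinearMap.range (restrictExtension ξ U)) <
      Module.finrank k (Hom U U) by omega
  refine Submodule.finrank_lt fun htop => hξ ?_
  obtain ⟨f, hf⟩ := LinearMap.range_eq_top.1 htop ⟨_, id_mem_Hom⟩
  have hf' : ∀ i (x : U.space i), f.1 i (x, 0) = x := fun i x =>
    congrArg (fun g : Hom U U => g.1 i x) hf
  refine ⟨fun i => -(f.1 i ∘ₗ LinearMap.inr k (U.space i) (V.space i)), ?_⟩
  ext i j h x
  rw [coboundary_apply]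
  have h4 := (mem_Hom_extension_left ξ).1 f.2 i j h (0, x)
  have h5 : f.1 j (U.map h 0 + ξ i j h x, V.map h x) =
      f.1 j (ξ i j h x, 0) + f.1 j (0, V.map h x) := by
    rw [← map_add (f.1 j)]
    exact congrArg _ (by simp)
  rw [h5, hf'] at h4
  change -(f.1 j (0, V.map h x)) - U.map h (-(f.1 i (0, x))) = ξ i j h x
  rw [map_neg, ← h4]
  abel

theorem finrank_Hom_extension_right_le : Module.finrank k (Hom Z (extension U V ξ)) ≤
    Module.finrank k (Hom Z U) + Module.finrank k (Hom Z V) := by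
  have h1 := LinearMap.finrank_range_add_finrank_ker (projectExtension ξ Z)
  have h2 := Submodule.finrank_le (LinearMap.range (projectExtension ξ Z))
  suffices h3 : Module.finrank k (LinearMap.ker (projectExtension ξ Z)) ≤
      Module.finrank k (Hom Z U) by omega
  have hzero : ∀ (f : LinearMap.ker (projectExtension ξ Z)) (i : I) (x : Z.space i),
      (f.1.1 i x).2 = 0 := fun f i x =>
    congrArg (fun g : Hom Z V => g.1 i x) (LinearMap.mem_ker.1 f.2)
  let s : LinearMap.ker (projectExtension ξ Z) →ₗ[k] Hom Z U :=
    { toFun f := ⟨fun i => LinearMap.fst k (U.space i) (V.space i) ∘ₗ f.1.1 i,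
        mem_Hom.2 fun i j h x => by
          have h1 := congrArg Prod.fst ((mem_Hom_extension_right ξ).1 f.1.2 i j h x)
          rw [hzero, map_zero, add_zero] at h1
          exact h1⟩
      map_add' _ _ := rfl
      map_smul' _ _ := rfl }
  refine LinearMap.finrank_le_finrank_of_injective (f := s)
    fun f f' hf => ?_
  refine Subtype.ext (Subtype.ext (funext fun i => LinearMap.ext fun x => ?_))
  exact Prod.ext (congrArg (fun g : Hom Z U => g.1 i x) hf)
    ((hzero f i x).trans (hzero f' i x).symm)

theorem le_finrank_Hom_directSum :
    Module.finrank k (Hom U U) + Module.finrank k (Hom V U) +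
      (Module.finrank k (Hom U V) + Module.finrank k (Hom V V)) ≤
    Module.finrank k (Hom (U.directSum V) (U.directSum V)) := by
  have : ∀ i, FiniteDimensional k ((U.directSum V).space i) := fun i =>
    inferInstanceAs (FiniteDimensional k (U.space i × V.space i))
  let s : ((Hom U U × Hom V U) × (Hom U V × Hom V V)) →ₗ[k]
      Hom (U.directSum V) (U.directSum V) :=
    { toFun f := ⟨fun i => ((f.1.1.1 i).coprod (f.1.2.1 i)).prod ((f.2.1.1 i).coprod (f.2.2.1 i)),
        mem_Hom.2 fun i j h x => by
          refine Prod.ext ?_ ?_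
          · change f.1.1.1 j (U.map h x.1) + f.1.2.1 j (V.map h x.2) =
              U.map h (f.1.1.1 i x.1 + f.1.2.1 i x.2)
            rw [map_add, mem_Hom.1 f.1.1.2, mem_Hom.1 f.1.2.2]
          · change f.2.1.1 j (U.map h x.1) + f.2.2.1 j (V.map h x.2) =
              V.map h (f.2.1.1 i x.1 + f.2.2.1 i x.2)
            rw [map_add, mem_Hom.1 f.2.1.2, mem_Hom.1 f.2.2.2]⟩
      map_add' f g := Subtype.ext (funext fun i => LinearMap.ext fun x =>
        Prod.ext (add_add_add_comm _ _ _ _) (add_add_add_comm _ _ _ _))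
      map_smul' c f := Subtype.ext (funext fun i => LinearMap.ext fun x =>
        Prod.ext (smul_add c _ _).symm (smul_add c _ _).symm) }
  have hs : Function.Injective s := (injective_iff_map_eq_zero s).2 fun f hf => by
    have h : ∀ i (x : U.space i) (y : V.space i),
        (f.1.1.1 i x + f.1.2.1 i y, f.2.1.1 i x + f.2.2.1 i y) = (0 : U.space i × V.space i) :=
      fun i x y => congrArg (fun g : Hom (U.directSum V) (U.directSum V) => g.1 i (x, y)) hf
    refine Prod.ext (Prod.ext (Subtype.ext ?_) (Subtype.ext ?_))
      (Prod.ext (Subtype.ext ?_) (Subtype.ext ?_))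
    · exact funext fun i => LinearMap.ext fun x => by
        simpa using congrArg Prod.fst (h i x 0)
    · exact funext fun i => LinearMap.ext fun x => by
        simpa using congrArg Prod.fst (h i 0 x)
    · exact funext fun i => LinearMap.ext fun x => by
        simpa using congrArg Prod.snd (h i x 0)
    · exact funext fun i => LinearMap.ext fun x => by
        simpa using congrArg Prod.snd (h i 0 x)
  have h1 := LinearMap.finrank_le_finrank_of_injective hs
  simpa only [Module.finrank_prod] using h1

/-- A nonsplit extension has fewer endomorphisms than the direct sum of its ends. -/
theorem finrank_Hom_extension_self_lt (hξ : ξ ∉ LinearMap.range (coboundary V U)) :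
    Module.finrank k (Hom (extension U V ξ) (extension U V ξ)) <
      Module.finrank k (Hom (U.directSum V) (U.directSum V)) := by
  have h1 := finrank_Hom_extension_right_le ξ (Z := extension U V ξ)
  have h2 := finrank_Hom_extension_lt ξ hξ
  have h3 := finrank_Hom_extension_left_le ξ (Z := V)
  have h4 := le_finrank_Hom_directSum (U := U) (V := V)
  omega

end Extension

theorem IsIsomorphic.finrank_Hom_le [Finite I] (h : V.IsIsomorphic W)
    [∀ i, FiniteDimensional k (V.space i)] :
    Module.finrank k (Hom W W) ≤ Module.finrank k (Hom V V) := by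
  obtain ⟨φ, hφ⟩ := h
  have hφ' : ∀ (i j : I) (h : i ⟶ j) (y : W.space i),
      (φ j).symm (W.map h y) = V.map h ((φ i).symm y) := fun i j h y => by
    rw [LinearEquiv.symm_apply_eq, hφ, LinearEquiv.apply_symm_apply]
  let s : Hom W W →ₗ[k] Hom V V :=
    { toFun f := ⟨fun i => (φ i).symm.toLinearMap ∘ₗ f.1 i ∘ₗ (φ i).toLinearMap,
        mem_Hom.2 fun i j h x => by
          change (φ j).symm (f.1 j (φ j (V.map h x))) = V.map h ((φ i).symm (f.1 i (φ i x)))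
          rw [hφ, mem_Hom.1 f.2, hφ']⟩
      map_add' f g := Subtype.ext (funext fun i => LinearMap.ext fun x => map_add (φ i).symm _ _)
      map_smul' c f := Subtype.ext (funext fun i => LinearMap.ext fun x =>
        map_smul (φ i).symm c _) }
  refine LinearMap.finrank_le_finrank_of_injective (f := s)
    (LinearMap.ker_eq_bot.1 (LinearMap.ker_eq_bot'.2 fun f hf => ?_))
  refine Subtype.ext (funext fun i => LinearMap.ext fun y => ?_)
  have h1 : (φ i).symm (f.1 i (φ i ((φ i).symm y))) = 0 :=
    congrArg (fun g : Hom V V => g.1 i ((φ i).symm y)) hf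
  rw [LinearEquiv.apply_symm_apply, LinearEquiv.map_eq_zero_iff] at h1
  exact h1

/-- Existence of an indecomposable representation whose dimension vector is a given vector of norm
`1`: among the representations with that dimension vector, one with the fewest endomorphisms cannot
be decomposed as `U ⊕ V`, since there would be no nonsplit extension between `U` and `V`, and the
norm of `dim U + dim V` would be at least `2`. -/
theorem exists_isIndecomposable_dimVector_eq [Fintype I] [∀ i j : I, Finite (i ⟶ j)]
    (hpos : ∀ x : I → ℤ, x ≠ 0 → 0 < eulerForm x x) {α : I → ℤ} (hα : ∀ i, 0 ≤ α i)
    (hα1 : eulerForm α α = 1) : ∃ V : QuiverRep.{u, v, w} k I,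
      V.IsIndecomposable ∧ V.IsFiniteDimensional ∧ V.dimVector = α := by
  have hex : ∃ n : ℕ, ∃ X : QuiverRep.{u, v, w} k I, X.IsFiniteDimensional ∧ X.dimVector = α ∧
      Module.finrank k (Hom X X) = n := by
    refine ⟨_, ⟨fun i => ULift.{max u v w} (Fin (α i).toNat → k), fun _ => 0⟩, fun i => ?_,
      funext fun i => ?_, rfl⟩
    · exact inferInstanceAs (FiniteDimensional k (ULift.{max u v w} (Fin (α i).toNat → k)))
    · have h1 : Module.finrank k (ULift.{max u v w} (Fin (α i).toNat → k)) = (α i).toNat := by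
        rw [LinearEquiv.finrank_eq ULift.moduleEquiv, Module.finrank_fin_fun]
      exact (congrArg Nat.cast h1).trans (Int.toNat_of_nonneg (hα i))
  classical
  obtain ⟨X, hX, hXα, hXn⟩ := Nat.find_spec hex
  have hX' : ∀ i, FiniteDimensional k (X.space i) := hX
  have hext : ∀ U V : QuiverRep.{u, v, w} k I, X.IsIsomorphic (U.directSum V) →
      ExtVanishes V U := by
    intro U V h
    have := finiteDimensional_of_isIsomorphic_directSum h
    have := finiteDimensional_of_isIsomorphic_directSum (h.trans (directSum_comm U V))
    by_contra hnot
    obtain ⟨ξ, hξ⟩ : ∃ ξ, ξ ∉ LinearMap.range (coboundary V U) := by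
      by_contra! h
      exact hnot fun ξ => h ξ
    have h1 := finrank_Hom_extension_self_lt ξ hξ
    have h2 := h.finrank_Hom_le
    have h3 : (extension U V ξ).dimVector = α := by
      rw [← hXα, h.dimVector_eq]
      rfl
    have h4 := Nat.find_min' hex ⟨extension U V ξ, fun i => inferInstance, h3, rfl⟩
    omega
  refine ⟨X, ⟨fun h0 => ?_, ?_⟩, hX, hXα⟩
  · have : α = 0 := by
      rw [← hXα]
      exact funext fun i => by
        have := h0 i
        simp [dimVector, Module.finrank_zero_of_subsingleton]
    subst this
    simp [eulerForm] at hα1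
  · rintro ⟨U, V, hU, hV, h⟩
    have hU' := finiteDimensional_of_isIsomorphic_directSum h
    have hV' := finiteDimensional_of_isIsomorphic_directSum (h.trans (directSum_comm U V))
    have h1 := (hext U V h).eulerForm_eq
    have h2 := (hext V U (h.trans (directSum_comm U V))).eulerForm_eq
    have h3 := hpos _ (dimVector_ne_zero hU)
    have h4 := hpos _ (dimVector_ne_zero hV)
    rw [← hXα, h.dimVector_eq, dimVector_directSum, eulerForm_add_left, eulerForm_add_right,
      eulerForm_add_right] at hα1
    omega

end QuiverRep

namespace QuiverRep

variable {k : Type u} [Field k] {I : Type v} [Quiver.{w} I] {U V W X Y Z : QuiverRep.{u, v, w} k I}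

/-! ### Infinite-dimensional representations -/

/-- In a finite quiver without oriented cycles, finite-dimensional families of subspaces generate
finite-dimensional subrepresentations. -/
theorem exists_isInvariant_finiteDimensional [Finite I] [∀ i j : I, Finite (i ⟶ j)]
    (hwf : WellFounded fun i j : I => Nonempty (i ⟶ j)) (p : ∀ i, Submodule k (V.space i))
    [∀ i, FiniteDimensional k (p i)] : ∃ q : ∀ i, Submodule k (V.space i),
      V.IsInvariant q ∧ (∀ i, p i ≤ q i) ∧ ∀ i, FiniteDimensional k (q i) := by
  let F : ∀ j : I, (∀ i, Nonempty (i ⟶ j) → Submodule k (V.space i)) → Submodule k (V.space j) :=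
    fun j G => p j ⊔ ⨆ b : (Σ i, (i ⟶ j)), (G b.1 ⟨b.2⟩).map (V.map b.2)
  have hF : ∀ j, hwf.fix F j = p j ⊔ ⨆ b : (Σ i, (i ⟶ j)), (hwf.fix F b.1).map (V.map b.2) :=
    fun j => hwf.fix_eq F j
  refine ⟨hwf.fix F, fun i j h x hx => ?_, fun i => ?_, fun i => ?_⟩
  · rw [hF j]
    exact Submodule.mem_sup_right (Submodule.mem_iSup_of_mem (⟨i, h⟩ : Σ i, (i ⟶ j))
      (Submodule.mem_map_of_mem hx))
  · rw [hF i]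
    exact le_sup_left
  · induction i using hwf.induction with
    | _ i ih =>
    have (b : Σ j, (j ⟶ i)) : FiniteDimensional k ((hwf.fix F b.1).map (V.map b.2)) := by
      have := ih b.1 ⟨b.2⟩
      infer_instance
    rw [hF i]
    infer_instance

section Compactness

open TensorProduct

variable [Fintype I] [DecidableEq I]

/-- The linear form on `⨁ i, V_i ⊗ X_i^*` attached to a family of linear maps `V_i → X_i`. -/
noncomputable def tensorForm (r : ∀ i, V.space i →ₗ[k] X.space i) :
    (∀ i, V.space i ⊗[k] Module.Dual k (X.space i)) →ₗ[k] k :=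
  LinearMap.lsum k _ k fun i => TensorProduct.lift (Module.Dual.eval k (X.space i) ∘ₗ r i)

theorem tensorForm_single (r : ∀ i, V.space i →ₗ[k] X.space i) (i : I) (x : V.space i)
    (μ : Module.Dual k (X.space i)) :
    tensorForm r (Pi.single i (x ⊗ₜ[k] μ)) = μ (r i x) := by
  rw [tensorForm, LinearMap.lsum_piSingle]
  rfl

/-- A compactness principle. Suppose that `X` is finite-dimensional and that `g : X → V` is split
on every finite-dimensional subrepresentation of `V` containing its image. Then no nonzero `x` is
killed by all the compositions of `g` with homomorphisms `V → X`.

The homomorphisms `V → X` are the linear forms on `⨁ i, V_i ⊗ X_i^*` that vanish on certain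
relations. A linear dependence between these relations and the vector `g x ⊗ μ`, where `μ x ≠ 0`,
involves only finitely many vectors of `V`, hence takes place in a finite-dimensional
subrepresentation, where a retraction of `g` excludes it. -/
theorem exists_Hom_apply_ne_zero [∀ i j : I, Finite (i ⟶ j)]
    (hwf : WellFounded fun i j : I => Nonempty (i ⟶ j)) [∀ i, FiniteDimensional k (X.space i)]
    {g : ∀ i, X.space i →ₗ[k] V.space i}
    (hlocal : ∀ p : ∀ i, Submodule k (V.space i), V.IsInvariant p →
      (∀ i, FiniteDimensional k (p i)) → (∀ i, LinearMap.range (g i) ≤ p i) →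
      ∃ r : ∀ i, V.space i →ₗ[k] X.space i,
        (∀ (i j : I) (h : i ⟶ j), ∀ y ∈ p i, r j (V.map h y) = X.map h (r i y)) ∧
        ∀ i x, r i (g i x) = x)
    {i₀ : I} {x₀ : X.space i₀} (hx₀ : x₀ ≠ 0) : ∃ r ∈ Hom V X, r i₀ (g i₀ x₀) ≠ 0 := by
  obtain ⟨μ₀, hμ₀⟩ : ∃ μ : Module.Dual k (X.space i₀), μ x₀ ≠ 0 := by
    by_contra! h
    exact hx₀ ((Module.forall_dual_apply_eq_zero_iff k x₀).1 h)
  let S : Set (∀ i, V.space i ⊗[k] Module.Dual k (X.space i)) :=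
    {m | ∃ (i j : I) (h : i ⟶ j) (y : V.space i) (μ : Module.Dual k (X.space j)),
      m = Pi.single j (V.map h y ⊗ₜ[k] μ) - Pi.single i (y ⊗ₜ[k] (μ ∘ₗ X.map h))}
  have hS : ∀ m ∈ Submodule.span k S, ∃ p : ∀ i, Submodule k (V.space i),
      (∀ i, FiniteDimensional k (p i)) ∧ ∀ r : ∀ i, V.space i →ₗ[k] X.space i,
        (∀ (i j : I) (h : i ⟶ j), ∀ y ∈ p i, r j (V.map h y) = X.map h (r i y)) →
        tensorForm r m = 0 := by
    intro m hm
    induction hm using Submodule.span_induction with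
    | mem m hm =>
      obtain ⟨i, j, h, y, μ, rfl⟩ := hm
      refine ⟨Function.update (fun _ => ⊥) i (Submodule.span k {y}), fun l => ?_, fun r hr => ?_⟩
      · by_cases hl : l = i
        · subst hl
          rw [Function.update_self]
          infer_instance
        · rw [Function.update_of_ne hl]
          infer_instance
      · rw [map_sub, tensorForm_single, tensorForm_single, hr i j h y, LinearMap.comp_apply,
          sub_self]
        rw [Function.update_self]
        exact Submodule.mem_span_singleton_self y
    | zero => exact ⟨fun _ => ⊥, fun _ => inferInstance, fun r _ => map_zero _⟩
    | add m m' _ _ h h' =>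
      obtain ⟨p, hp, hpr⟩ := h
      obtain ⟨p', hp', hpr'⟩ := h'
      refine ⟨fun i => p i ⊔ p' i, fun i => inferInstance, fun r hr => ?_⟩
      rw [map_add, hpr r fun i j h y hy => hr i j h y (Submodule.mem_sup_left hy),
        hpr' r fun i j h y hy => hr i j h y (Submodule.mem_sup_right hy), add_zero]
    | smul c m _ h =>
      obtain ⟨p, hp, hpr⟩ := h
      refine ⟨p, hp, fun r hr => ?_⟩
      rw [map_smul, hpr r hr, smul_zero]
  have hγ : (Pi.single i₀ (g i₀ x₀ ⊗ₜ[k] μ₀) :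
      ∀ i, V.space i ⊗[k] Module.Dual k (X.space i)) ∉ Submodule.span k S := fun hmem => by
    obtain ⟨p, hp, hpr⟩ := hS _ hmem
    obtain ⟨q, hq, hpq, hqfin⟩ := exists_isInvariant_finiteDimensional (V := V) hwf
      fun i => p i ⊔ LinearMap.range (g i)
    obtain ⟨r, hr, hrg⟩ := hlocal q hq hqfin fun i => le_sup_right.trans (hpq i)
    have h := hpr r fun i j h y hy => hr i j h y (hpq i (Submodule.mem_sup_left hy))
    rw [tensorForm_single, hrg] at h
    exact hμ₀ h
  obtain ⟨F, hFγ, hF⟩ := Submodule.exists_le_ker_of_notMem hγ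
  let r : ∀ i, V.space i →ₗ[k] X.space i := fun i =>
    (Module.evalEquiv k (X.space i)).symm.toLinearMap ∘ₗ TensorProduct.curry (F ∘ₗ
      LinearMap.single k (fun i => V.space i ⊗[k] Module.Dual k (X.space i)) i)
  have hr : ∀ i y (μ : Module.Dual k (X.space i)), μ (r i y) = F (Pi.single i (y ⊗ₜ[k] μ)) :=
    fun i y μ => Module.apply_evalEquiv_symm_apply k _ μ _
  refine ⟨r, mem_Hom.2 fun i j h y => ?_, fun h0 => hFγ ?_⟩
  · refine (Module.forall_dual_apply_eq_zero_iff k _).1 (fun μ => ?_) |> sub_eq_zero.1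
    have h1 : F (Pi.single j (V.map h y ⊗ₜ[k] μ) - Pi.single i (y ⊗ₜ[k] (μ ∘ₗ X.map h))) = 0 :=
      hF (Submodule.subset_span ⟨i, j, h, y, μ, rfl⟩)
    rw [map_sub, ← hr, ← hr] at h1
    rw [map_sub]
    exact h1
  · rw [← hr, h0, map_zero]

end Compactness

section PointedTest

/-- A triple `(X, g, x)` with `X` finite-dimensional indecomposable, `g : X → V` a homomorphism and
`x` a vector of `X_i` not killed by `g`. -/
structure PointedTest (V : QuiverRep.{u, v, w} k I) (i : I) where
  /-- The source of the homomorphism. -/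
  rep : QuiverRep.{u, v, w} k I
  isIndecomposable : rep.IsIndecomposable
  finiteDimensional : ∀ j, FiniteDimensional k (rep.space j)
  /-- The homomorphism to `V`. -/
  hom : ∀ j, rep.space j →ₗ[k] V.space j
  hom_mem : hom ∈ Hom rep V
  /-- The vector. -/
  vec : rep.space i
  hom_vec_ne_zero : hom i vec ≠ 0

variable {i : I}

/-- The target of a homomorphism carrying the one vector to the other which is not a split
monomorphism. -/
def PointedTest.Lt (s t : PointedTest V i) : Prop :=
  ∃ c ∈ Hom s.rep t.rep, c i s.vec = t.vec ∧ ¬ ∃ r ∈ Hom t.rep s.rep, ∀ j y, r j (c j y) = y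

theorem PointedTest.Lt.trans {s t t' : PointedTest V i} (h : s.Lt t) (h' : t.Lt t') : s.Lt t' := by
  obtain ⟨c, hc, hcx, hcs⟩ := h
  obtain ⟨c', hc', hcx', -⟩ := h'
  refine ⟨_, comp_mem_Hom hc' hc, (congrArg (c' i) hcx).trans hcx', ?_⟩
  rintro ⟨r, hr, hrc⟩
  exact hcs ⟨_, comp_mem_Hom hr hc', hrc⟩

theorem PointedTest.vec_ne_zero (s : PointedTest V i) : s.vec ≠ 0 := fun h =>
  s.hom_vec_ne_zero (by rw [h, map_zero])

variable [Fintype I]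

theorem PointedTest.Lt.dimVector_ne [∀ i j : I, Finite (i ⟶ j)]
    (hpos : ∀ x : I → ℤ, x ≠ 0 → 0 < eulerForm x x)
    {s t : PointedTest V i} (h : s.Lt t) : s.rep.dimVector ≠ t.rep.dimVector := fun heq => by
  have := s.finiteDimensional
  have := t.finiteDimensional
  obtain ⟨c, hc, hcx, hcs⟩ := h
  obtain ⟨ψ, hψ⟩ :=
    t.isIndecomposable.isIsomorphic_of_dimVector_eq hpos s.isIndecomposable heq.symm
  have hψ' : (fun j => (ψ j).toLinearMap) ∈ Hom t.rep s.rep := mem_Hom.2 hψ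
  obtain ⟨b, hb, hb', -⟩ := exists_inverse_of_bijective (comp_mem_Hom hψ' hc)
    (s.isIndecomposable.isBrick hpos _ (comp_mem_Hom hψ' hc) fun h0 => t.vec_ne_zero <| by
      have h1 : ψ i (c i s.vec) = 0 := LinearMap.congr_fun (congrFun h0 i) s.vec
      rwa [hcx, LinearEquiv.map_eq_zero_iff] at h1)
  exact hcs ⟨_, comp_mem_Hom hb hψ', hb'⟩

/-- The indecomposable summands of a finite-dimensional subrepresentation. -/
theorem PointedTest.exists_of_mem {q : ∀ j, Submodule k (V.space j)} (hq : V.IsInvariant q)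
    (hqfin : ∀ j, FiniteDimensional k (q j)) {x : V.space i} (hx : x ∈ q i) (hx0 : x ≠ 0) :
    ∃ s : PointedTest V i, ∃ π ∈ Hom (V.sub q hq) s.rep, π i ⟨x, hx⟩ = s.vec := by
  have : ∀ j, FiniteDimensional k ((V.sub q hq).space j) := hqfin
  obtain ⟨A, hA, hAfin, ι, hι, π, hπ, hπι, hπx⟩ :=
    exists_indecomposable_summand (V.sub q hq) (i := i)
      (u := (⟨x, hx⟩ : (V.sub q hq).space i)) fun h => hx0 (congrArg Subtype.val h)
  refine ⟨⟨A, hA, hAfin, _, comp_mem_Hom (subtype_mem_Hom hq) hι, π i ⟨x, hx⟩, fun h => hπx ?_⟩,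
    π, hπ, rfl⟩
  refine (hπι i _).symm.trans ((congrArg (π i) (?_ : ι i (π i ⟨x, hx⟩) = 0)).trans
    (map_zero (π i)))
  exact Subtype.ext h

variable [∀ i j : I, Finite (i ⟶ j)]

/-- As there are finitely many possible dimension vectors, there are maximal triples. -/
theorem PointedTest.exists_maximal (hpos : ∀ x : I → ℤ, x ≠ 0 → 0 < eulerForm x x)
    (hfin : {x : I → ℤ | eulerForm x x = 1}.Finite) (s₀ : PointedTest V i) :
    ∃ s : PointedTest V i, ∀ t, ¬ s.Lt t := by
  let D : PointedTest V i → Set (I → ℤ) := fun s => {d | ∃ t, s.Lt t ∧ t.rep.dimVector = d}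
  have hD : ∀ s, (D s).Finite := fun s => hfin.subset <| by
    rintro _ ⟨t, -, rfl⟩
    have := t.finiteDimensional
    exact t.isIndecomposable.eulerForm_eq_one hpos
  have hex : ∃ n : ℕ, ∃ s : PointedTest V i, (D s).ncard = n := ⟨_, s₀, rfl⟩
  classical
  obtain ⟨s, hs⟩ := Nat.find_spec hex
  refine ⟨s, fun t hst => ?_⟩
  have h1 : (D t).ncard < (D s).ncard := by
    refine Set.ncard_lt_ncard ⟨?_, fun hle => ?_⟩ (hD s)
    · rintro d ⟨t', ht', rfl⟩
      exact ⟨t', hst.trans ht', rfl⟩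
    · obtain ⟨t', ht', heq⟩ := hle ⟨t, hst, rfl⟩
      exact ht'.dimVector_ne hpos heq.symm
  have h2 := Nat.find_min' hex ⟨t, rfl⟩
  omega

/-- A maximal triple `(X, g, x)` splits on every finite-dimensional subrepresentation containing
the image of `g`, so that by compactness `X` is a direct summand of `V`. -/
theorem IsIndecomposable.isFiniteDimensional (hpos : ∀ x : I → ℤ, x ≠ 0 → 0 < eulerForm x x)
    (hfin : {x : I → ℤ | eulerForm x x = 1}.Finite) (hV : V.IsIndecomposable) :
    V.IsFiniteDimensional := by
  classical
  have hwf := wellFounded_arrow_of_eulerForm_pos hpos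
  obtain ⟨i, v, hv⟩ : ∃ (i : I) (v : V.space i), v ≠ 0 := by
    by_contra! h
    exact hV.1 fun i => ⟨fun x y => (h i x).trans (h i y).symm⟩
  obtain ⟨s₀⟩ : Nonempty (PointedTest V i) := by
    have : ∀ j, FiniteDimensional k (Function.update (fun j => (⊥ : Submodule k (V.space j))) i
        (Submodule.span k {v}) j) := fun j => by
      by_cases hj : j = i
      · subst hj
        rw [Function.update_self]
        infer_instance
      · rw [Function.update_of_ne hj]
        infer_instance
    obtain ⟨q, hq, hpq, hqfin⟩ := exists_isInvariant_finiteDimensional (V := V) hwf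
      (Function.update (fun j => (⊥ : Submodule k (V.space j))) i (Submodule.span k {v}))
    have hvq : v ∈ q i := hpq i (by
      rw [Function.update_self]
      exact Submodule.mem_span_singleton_self v)
    obtain ⟨s, -⟩ := PointedTest.exists_of_mem hq hqfin hvq hv
    exact ⟨s⟩
  obtain ⟨s, hs⟩ := PointedTest.exists_maximal hpos hfin s₀
  have := s.finiteDimensional
  obtain ⟨r, hr, hrx⟩ : ∃ r ∈ Hom V s.rep, r i (s.hom i s.vec) ≠ 0 := by
    refine exists_Hom_apply_ne_zero hwf (fun q hq hqfin hle => ?_) s.vec_ne_zero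
    obtain ⟨t, π, hπ, hπt⟩ := PointedTest.exists_of_mem hq hqfin (hle i ⟨s.vec, rfl⟩)
      s.hom_vec_ne_zero
    have hg : (fun j => (s.hom j).codRestrict (q j) fun x => hle j ⟨x, rfl⟩) ∈
        Hom s.rep (V.sub q hq) :=
      mem_Hom.2 fun a b h x => Subtype.ext (mem_Hom.1 s.hom_mem a b h x)
    obtain ⟨r, hr, hrc⟩ : ∃ r ∈ Hom t.rep s.rep, ∀ j y,
        r j (π j ((s.hom j).codRestrict (q j) (fun x => hle j ⟨x, rfl⟩) y)) = y := by
      by_contra hcon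
      exact hs t ⟨_, comp_mem_Hom hπ hg, hπt, hcon⟩
    choose r' hr' using fun j => (r j ∘ₗ π j).exists_extend
    have hr'' : ∀ j (y : q j), r' j y = r j (π j y) := fun j y => LinearMap.congr_fun (hr' j) y
    refine ⟨r', fun a b h y hy => ?_, fun j x => ?_⟩
    · rw [hr'' a ⟨y, hy⟩, hr'' b ⟨_, hq a b h y hy⟩]
      exact mem_Hom.1 (comp_mem_Hom hr hπ) a b h ⟨y, hy⟩
    · exact (hr'' j ⟨s.hom j x, hle j ⟨x, rfl⟩⟩).trans (hrc j x)
  obtain ⟨b, hb, hb', -⟩ := exists_inverse_of_bijective (comp_mem_Hom hr s.hom_mem)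
    (s.isIndecomposable.isBrick hpos _ (comp_mem_Hom hr s.hom_mem) fun h0 =>
      hrx (LinearMap.congr_fun (congrFun h0 i) s.vec))
  have hb'' : ∀ j x, b j (r j (s.hom j x)) = x := hb'
  rcases hV.eq_zero_or_eq_id (comp_mem_Hom s.hom_mem (comp_mem_Hom hb hr))
    (fun j y => congrArg (s.hom j) (hb'' j _)) with h | h
  · refine absurd (h i (s.hom i s.vec)) fun h1 => s.hom_vec_ne_zero ?_
    exact (congrArg (s.hom i) (hb'' i s.vec)).symm.trans h1
  · exact fun j => Module.Finite.of_surjective (s.hom j) fun y => ⟨_, h j y⟩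

end PointedTest

end QuiverRep

/-! ### Gabriel's theorem -/

/-- Roots are the vectors of norm `2`, as the form is even, positive definite and takes the value
`2` on the coordinate vectors. -/
theorem IsUnderlyingGraph.isRoot_iff {I : Type v} [Fintype I] [DecidableEq I] [Quiver.{w} I]
    {Γ : SimpleGraph I} [DecidableRel Γ.Adj] (hQ : IsUnderlyingGraph Γ)
    (hpos : ∀ x : I → ℤ, x ≠ 0 → 0 < eulerForm x x) (x : I → ℤ) :
    IsRoot Γ x ↔ eulerForm x x = 1 := by
  refine ⟨fun ⟨hx, hmin⟩ => ?_, fun h => ⟨?_, fun y hy => ?_⟩⟩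
  · obtain ⟨i, -⟩ := Function.ne_iff.1 hx
    have h1 := hmin (Pi.single i 1) (by simp)
    have h2 : cartanForm Γ (Pi.single i 1) (Pi.single i 1) = 2 := by
      simp [cartanForm, cartanMatrix, Matrix.ofNat_apply]
    have h3 := hpos x hx
    have h4 := hQ.cartanForm_eq x
    omega
  · rintro rfl
    simp [eulerForm] at h
  · have h1 := hpos y hy
    rw [hQ.cartanForm_eq, hQ.cartanForm_eq]
    omega

theorem mainTheorem1 {k : Type u} [Field k] {I : Type v} [Fintype I] [DecidableEq I]
    [Quiver.{w} I] [∀ i j : I, Finite (i ⟶ j)]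
    (Γ : SimpleGraph I) [DecidableRel Γ.Adj] (hΓ : IsADE Γ) (hQ : IsUnderlyingGraph Γ) :
    -- there are finitely many indecomposable representations up to isomorphism
    Finite (QuiverRep.IndecomposableClass k I) ∧
    -- every indecomposable is finite-dimensional, and its dimension vector is a positive root
    (∀ V : QuiverRep k I, V.IsIndecomposable →
      V.IsFiniteDimensional ∧ IsPositiveRoot Γ V.dimVector) ∧
    -- every positive root is the dimension vector of exactly one indecomposable
    (∀ α : I → ℤ, IsPositiveRoot Γ α →
      (∃ V : QuiverRep k I, V.IsIndecomposable ∧ V.IsFiniteDimensional ∧ V.dimVector = α) ∧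
      (∀ V W : QuiverRep k I, V.IsIndecomposable → W.IsIndecomposable →
        V.dimVector = α → W.dimVector = α → V.IsIsomorphic W)) := by
  obtain ⟨v, hv⟩ := hΓ.exists_isSuperharmonic
  have hpos : ∀ x : I → ℤ, x ≠ 0 → 0 < eulerForm x x := fun x hx => by
    have h1 := hv.cartanForm_pos hx
    have h2 := hQ.cartanForm_eq x
    omega
  have hfin : {x : I → ℤ | eulerForm x x = 1}.Finite :=
    (hv.finite_cartanForm_eq 2).subset fun x (hx : eulerForm x x = 1) => by
      change cartanForm Γ x x = 2
      rw [hQ.cartanForm_eq, hx, mul_one]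
  have hfd : ∀ V : QuiverRep k I, V.IsIndecomposable → ∀ i, FiniteDimensional k (V.space i) :=
    fun V hV => hV.isFiniteDimensional hpos hfin
  have hroot : ∀ V : QuiverRep k I, V.IsIndecomposable →
      eulerForm V.dimVector V.dimVector = 1 := fun V hV => by
    have := hfd V hV
    exact hV.eulerForm_eq_one hpos
  have huniq : ∀ V W : QuiverRep k I, V.IsIndecomposable → W.IsIndecomposable →
      V.dimVector = W.dimVector → V.IsIsomorphic W := fun V W hV hW h => by
    have := hfd V hV
    have := hfd W hW
    exact hV.isIsomorphic_of_dimVector_eq hpos hW h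
  refine ⟨?_, fun V hV => ⟨hfd V hV, (hQ.isRoot_iff hpos _).2 (hroot V hV),
    fun i => Int.natCast_nonneg _⟩, fun α hα => ⟨?_, fun V W hV hW hVα hWα =>
      huniq V W hV hW (hVα.trans hWα.symm)⟩⟩
  · have := hfin.to_subtype
    refine Finite.of_injective (β := {x : I → ℤ | eulerForm x x = 1})
      (fun c : QuiverRep.IndecomposableClass k I =>
        ⟨(Quotient.out c).1.dimVector, hroot _ (Quotient.out c).2⟩) fun c d hcd => ?_
    rw [← Quotient.out_eq c, ← Quotient.out_eq d]
    exact Quotient.sound (huniq _ _ (Quotient.out c).2 (Quotient.out d).2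
      (congrArg Subtype.val hcd))
  · exact QuiverRep.exists_isIndecomposable_dimVector_eq hpos hα.2 ((hQ.isRoot_iff hpos α).1 hα.1)
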